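/- Let $C$ be a generalized Cartan matrix of finite size, let $\mathcal G=\mathfrak g(C)$ be the complex Kac--Moody Lie algebra of $C$ attached to a realization $(\mathfrak h,\Pi,\Pi^\vee)$ of $C$ (the Lie algebra with generators $e_i,f_i$ and $\mathfrak h$ and relations $[e_i,f_j]=\delta_{ij}\alpha_i^\vee$, $[x,y]=0$, $[x,e_i]=\alpha_i(x)e_i$, $[x,f_i]=-\alpha_i(x)f_i$ for $x,y\in\mathfrak h$, divided by its largest ideal intersecting $\mathfrak h$ trivially), and let $h\subset\mathcal G$ be its Cartan subalgebra, the image of $\mathfrak h$. Put $\mathcal G'=[\mathcal G,\mathcal G]$, $h'=h\cap\mathcal G'$, let $N^+$ be the subalgebra of $\mathcal G$ generated by the $e_i$, and fix a vector space complement $h''$ of $h'$ in $h$, so $h=h'\oplus h''$. Let $n\ge 1$ and $A=\mathbb C[t_1^{\pm1},\dots,t_n^{\pm1}]$. For a subspace $S\subseteq\mathcal G$ write $S_A=S\otimes A$, and consider the Lie algebra $\mathcal G'_A\oplus h''$ with bracket $[x\otimes a,y\otimes b]=[x,y]\otimes ab$, $[k,x\otimes a]=[k,x]\otimes a$ and $[k,l]=0$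 for $x,y\in\mathcal G'$, $a,b\in A$, $k,l\in h''$; in it, $h=h'\oplus h''$ is embedded as $(h'\otimes 1)\oplus h''$. Let $H=(h'\otimes A)\oplus h''$. For a linear functional $\psi\in H^*$, let $\mathbb C(\psi)$ be the one-dimensional module of $B'=N^+_A\oplus H$ on which $N^+_A$ acts by $0$ and $H$ acts by $\psi$, let $M(\psi)=U(\mathcal G'_A\oplus h'')\otimes_{U(B')}\mathbb C(\psi)$, and let $V(\psi)$ be the quotient of $M(\psi)$ by its largest proper submodule (the unique irreducible quotient). For $\mu\in h^*$ the weight space $V_\mu(\psi)$ is $\{v\in V(\psi): xv=\mu(x)v\text{ for all }x\in h\}$. An ideal $I$ of $A$ is called cofinite if $\dim_{\mathbb C}A/I<\infty$, and $\psi$ is said to factor through $h'\otimes A/I$ if $\psi|_{h'\otimes A}$ is the composition of the natural map $h'\otimes A\to h'\otimes A/I$ with a linear functional on $h'\otimes A/I$. **Lemma.** All weight spaces $V_\mu(\psi)$, $\mu\in h^*$, are finite dimensional if and only if $\psi$ factors through $h'\otimes A/I$ for some cofinite ideal $I$ of $A$. Moreover, for every cofinite ideal $I$ of $A$ such that $\psi$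 factors through $h'\otimes A/I$, the subspace $\mathcal G'\otimes I$ acts by zero on $V(\psi)$. -/

import Mathlib

open scoped TensorProduct

noncomputable section

namespace LoopKacMoody

/-! ### Kac-Moody Lie algebras -/

/-- Generalized Cartan matrices. -/
structure IsGCM {ι : Type*} (A : Matrix ι ι ℤ) : Prop where
  diag : ∀ i, A i i = 2
  nonpos : ∀ i j, i ≠ j → A i j ≤ 0
  zero_symm : ∀ i j, A i j = 0 → A j i = 0

/-- A realization `(𝔥, Π, Π^∨)` of a square matrix `A`: linearly independent simple roots
`α_i ∈ 𝔥*` and simple coroots `α_i^∨ ∈ 𝔥` with `α_j (α_i^∨) = A i j`, where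
`dim 𝔥 = 2 * card ι - rank A`. -/
structure Realization {ι : Type*} [Fintype ι] (A : Matrix ι ι ℤ)
    (𝔥 : Type*) [AddCommGroup 𝔥] [Module ℂ 𝔥] where
  root : ι → Module.Dual ℂ 𝔥
  coroot : ι → 𝔥
  root_indep : LinearIndependent ℂ root
  coroot_indep : LinearIndependent ℂ coroot
  root_coroot : ∀ i j, root j (coroot i) = (A i j : ℂ)
  finrank_add_rank :
    Module.finrank ℂ 𝔥 + (A.map (Int.cast : ℤ → ℂ)).rank = 2 * Fintype.card ι

/-- Generators of the Kac-Moody algebra: `e_i`, `f_i` and the elements of `𝔥`. -/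
inductive Gen (ι 𝔥 : Type*)
  | e (i : ι) : Gen ι 𝔥
  | f (i : ι) : Gen ι 𝔥
  | c (x : 𝔥) : Gen ι 𝔥

section KacMoody

variable {ι : Type*} [Fintype ι] {A : Matrix ι ι ℤ}
  {𝔥 : Type*} [AddCommGroup 𝔥] [Module ℂ 𝔥]

/-- The image of a generator in the free Lie algebra. -/
abbrev gen {ι 𝔥 : Type*} (g : Gen ι 𝔥) : FreeLieAlgebra ℂ (Gen ι 𝔥) := FreeLieAlgebra.of ℂ g

/-- The elements of the free Lie algebra which are set to zero: `𝔥` is a linear subspace,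
`[e_i, f_j] = δ_ij α_i^∨`, `[x, y] = 0`, `[x, e_i] = α_i(x) e_i`, `[x, f_i] = -α_i(x) f_i`
for `x, y ∈ 𝔥`. -/
inductive Realization.IsRel (R : Realization A 𝔥) : FreeLieAlgebra ℂ (Gen ι 𝔥) → Prop
  | add (x y : 𝔥) : R.IsRel (gen (.c (x + y)) - (gen (.c x) + gen (.c y)))
  | smul (a : ℂ) (x : 𝔥) : R.IsRel (gen (.c (a • x)) - a • gen (.c x))
  | ef_same (i : ι) : R.IsRel (⁅gen (𝔥 := 𝔥) (.e i), gen (.f i)⁆ - gen (.c (R.coroot i)))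
  | ef_ne (i j : ι) (hij : i ≠ j) : R.IsRel ⁅gen (𝔥 := 𝔥) (.e i), gen (.f j)⁆
  | hh (x y : 𝔥) : R.IsRel ⁅gen (ι := ι) (.c x), gen (.c y)⁆
  | he (x : 𝔥) (i : ι) : R.IsRel (⁅gen (ι := ι) (.c x), gen (.e i)⁆ - R.root i x • gen (.e i))
  | hf (x : 𝔥) (i : ι) : R.IsRel (⁅gen (ι := ι) (.c x), gen (.f i)⁆ + R.root i x • gen (.f i))

/-- The ideal of relations. -/
def Realization.relIdeal (R : Realization A 𝔥) : LieIdeal ℂ (FreeLieAlgebra ℂ (Gen ι 𝔥)) :=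
  LieSubmodule.lieSpan ℂ (FreeLieAlgebra ℂ (Gen ι 𝔥)) {x | R.IsRel x}

/-- The auxiliary Lie algebra `𝔤̃(A)`. -/
def Realization.Aux (R : Realization A 𝔥) : Type _ :=
  FreeLieAlgebra ℂ (Gen ι 𝔥) ⧸ R.relIdeal

instance (R : Realization A 𝔥) : LieRing R.Aux :=
  inferInstanceAs (LieRing (FreeLieAlgebra ℂ (Gen ι 𝔥) ⧸ R.relIdeal))

instance (R : Realization A 𝔥) : LieAlgebra ℂ R.Aux :=
  inferInstanceAs (LieAlgebra ℂ (FreeLieAlgebra ℂ (Gen ι 𝔥) ⧸ R.relIdeal))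

/-- The class of a generator in the auxiliary Lie algebra. -/
def Realization.auxGen (R : Realization A 𝔥) (g : Gen ι 𝔥) : R.Aux :=
  LieSubmodule.Quotient.mk' R.relIdeal (gen g)

/-- The image of `𝔥` in the auxiliary Lie algebra. -/
def Realization.auxCartan (R : Realization A 𝔥) : Submodule ℂ R.Aux :=
  Submodule.span ℂ (Set.range fun x : 𝔥 => R.auxGen (.c x))

/-- The largest ideal of `𝔤̃(A)` intersecting `𝔥` trivially, as the sum of all such ideals. -/
def Realization.radical (R : Realization A 𝔥) : LieIdeal ℂ R.Aux :=
  sSup {I : LieIdeal ℂ R.Aux | Disjoint (LieSubmodule.toSubmodule I) R.auxCartan}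

/-- The Kac-Moody Lie algebra `𝒢 = 𝔤(A)`. -/
def Realization.Alg (R : Realization A 𝔥) : Type _ := R.Aux ⧸ R.radical

instance (R : Realization A 𝔥) : LieRing R.Alg :=
  inferInstanceAs (LieRing (R.Aux ⧸ R.radical))

instance (R : Realization A 𝔥) : LieAlgebra ℂ R.Alg :=
  inferInstanceAs (LieAlgebra ℂ (R.Aux ⧸ R.radical))

/-- The class of a generator in the Kac-Moody algebra. -/
def Realization.algGen (R : Realization A 𝔥) (g : Gen ι 𝔥) : R.Alg :=
  LieSubmodule.Quotient.mk' R.radical (R.auxGen g)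

/-- The Cartan subalgebra `h` of `𝒢`. -/
def Realization.cartan (R : Realization A 𝔥) : Submodule ℂ R.Alg :=
  Submodule.span ℂ (Set.range fun x : 𝔥 => R.algGen (.c x))

/-- The derived algebra `𝒢' = [𝒢, 𝒢]`. -/
def Realization.derived (R : Realization A 𝔥) : LieIdeal ℂ R.Alg :=
  ⁅(⊤ : LieIdeal ℂ R.Alg), (⊤ : LieIdeal ℂ R.Alg)⁆

/-- `h' = h ∩ 𝒢'`. -/
def Realization.cartan' (R : Realization A 𝔥) : Submodule ℂ R.Alg :=
  R.cartan ⊓ LieSubmodule.toSubmodule R.derived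

/-- The positive part `N⁺` of `𝒢`, the subalgebra generated by the `e_i`. -/
def Realization.nPos (R : Realization A 𝔥) : LieSubalgebra ℂ R.Alg :=
  LieSubalgebra.lieSpan ℂ R.Alg (Set.range fun i : ι => R.algGen (.e i))

/-- A vector space complement `h''` of `h'` in `h`. -/
structure Realization.Complement (R : Realization A 𝔥) where
  carrier : Submodule ℂ R.Alg
  disjoint : Disjoint R.cartan' carrier
  sup_eq : R.cartan' ⊔ carrier = R.cartan

end KacMoody

/-! ### The loop algebra `𝒢'_A ⊕ h''` -/

/-- `A = ℂ[t₁^{±1}, …, t_n^{±1}]`. -/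
def Laurent (n : ℕ) : Type := AddMonoidAlgebra ℂ (Fin n → ℤ)

instance (n : ℕ) : CommRing (Laurent n) :=
  inferInstanceAs (CommRing (AddMonoidAlgebra ℂ (Fin n → ℤ)))

instance (n : ℕ) : Algebra ℂ (Laurent n) :=
  inferInstanceAs (Algebra ℂ (AddMonoidAlgebra ℂ (Fin n → ℤ)))

section Loop

variable {ι : Type*} [Fintype ι] {C : Matrix ι ι ℤ}
  {𝔥 : Type*} [AddCommGroup 𝔥] [Module ℂ 𝔥] {R : Realization C 𝔥}

/-- The subspace `J ⊗ S` of `A ⊗ 𝒢`. -/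
def tensorSub {n : ℕ} (J : Submodule ℂ (Laurent n)) (S : Submodule ℂ R.Alg) :
    Submodule ℂ (Laurent n ⊗[ℂ] R.Alg) :=
  Submodule.map₂ (TensorProduct.mk ℂ (Laurent n) R.Alg) J S

/-- The subspace `1 ⊗ S` of `A ⊗ 𝒢`. -/
def oneSub (n : ℕ) (S : Submodule ℂ R.Alg) : Submodule ℂ (Laurent n ⊗[ℂ] R.Alg) :=
  S.map (TensorProduct.mk ℂ (Laurent n) R.Alg 1)

theorem lie_mem_tensorSub {n : ℕ} (x y : Laurent n ⊗[ℂ] R.Alg) :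
    ⁅x, y⁆ ∈ tensorSub (R := R) (n := n) ⊤ (LieSubmodule.toSubmodule R.derived) := by
  induction x using TensorProduct.induction_on with
  | zero => simp
  | add x x' hx hx' => rw [add_lie]; exact add_mem hx hx'
  | tmul a u =>
    induction y using TensorProduct.induction_on with
    | zero => simp
    | add y y' hy hy' => rw [lie_add]; exact add_mem hy hy'
    | tmul b w =>
      rw [LieAlgebra.ExtendScalars.bracket_tmul]
      exact Submodule.apply_mem_map₂ _ Submodule.mem_top
        (LieSubmodule.lie_mem_lie (LieSubmodule.mem_top u) (LieSubmodule.mem_top w))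

/-- The Lie algebra `𝒢'_A ⊕ h''`, where `𝒢'_A = 𝒢' ⊗ A`, with bracket
`[a ⊗ x, b ⊗ y] = ab ⊗ [x, y]`, realized inside `A ⊗ 𝒢` with `h''` embedded as `1 ⊗ h''`. -/
def loopAlg (n : ℕ) (K : R.Complement) : LieSubalgebra ℂ (Laurent n ⊗[ℂ] R.Alg) where
  toSubmodule := tensorSub ⊤ (LieSubmodule.toSubmodule R.derived) ⊔ oneSub n K.carrier
  lie_mem' := fun _ _ => Submodule.mem_sup_left (lie_mem_tensorSub _ _)

/-- `H = h' ⊗ A ⊕ h''`. -/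
def loopCartan (n : ℕ) (K : R.Complement) : Submodule ℂ (loopAlg n K) :=
  (tensorSub ⊤ R.cartan' ⊔ oneSub n K.carrier).comap (loopAlg n K).toSubmodule.subtype

/-- `N⁺_A = N⁺ ⊗ A`. -/
def loopPos (n : ℕ) (K : R.Complement) : Submodule ℂ (loopAlg n K) :=
  (tensorSub ⊤ R.nPos.toSubmodule).comap (loopAlg n K).toSubmodule.subtype

theorem tmul_mem_sup {n : ℕ} (K : R.Complement) (a : Laurent n) (x : R.cartan') :
    a ⊗ₜ[ℂ] (x : R.Alg) ∈ tensorSub (n := n) ⊤ R.cartan' ⊔ oneSub n K.carrier :=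
  Submodule.mem_sup_left (Submodule.apply_mem_map₂ _ Submodule.mem_top x.2)

theorem tmul_mem_loopAlg {n : ℕ} (K : R.Complement) (a : Laurent n) (x : R.cartan') :
    a ⊗ₜ[ℂ] (x : R.Alg) ∈ loopAlg n K :=
  Submodule.mem_sup_left (Submodule.apply_mem_map₂ _ Submodule.mem_top x.2.2)

/-- The element `a ⊗ x` of `H`, for `a ∈ A` and `x ∈ h'`. -/
def cartanTmul {n : ℕ} (K : R.Complement) (a : Laurent n) (x : R.cartan') : loopCartan n K :=
  ⟨⟨a ⊗ₜ[ℂ] (x : R.Alg), tmul_mem_loopAlg K a x⟩, tmul_mem_sup K a x⟩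

theorem one_tmul_mem {n : ℕ} (K : R.Complement) (x : R.cartan) :
    (1 : Laurent n) ⊗ₜ[ℂ] (x : R.Alg) ∈ loopAlg n K := by
  have hx : (x : R.Alg) ∈ R.cartan' ⊔ K.carrier := by
    rw [K.sup_eq]; exact x.2
  obtain ⟨y, hy, z, hz, hyz⟩ := Submodule.mem_sup.1 hx
  rw [← hyz, TensorProduct.tmul_add]
  exact add_mem (tmul_mem_loopAlg K 1 ⟨y, hy⟩)
    (Submodule.mem_sup_right (Submodule.mem_map_of_mem hz))

/-- `x ∈ h`, as the element `1 ⊗ x` of `𝒢'_A ⊕ h''`. -/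
def cartanOne (n : ℕ) (K : R.Complement) (x : R.cartan) : loopAlg n K :=
  ⟨(1 : Laurent n) ⊗ₜ[ℂ] (x : R.Alg), one_tmul_mem K x⟩

/-! ### Highest weight modules -/

/-- The universal enveloping algebra of `𝒢'_A ⊕ h''`. -/
abbrev Env (n : ℕ) (K : R.Complement) : Type _ := UniversalEnvelopingAlgebra ℂ (loopAlg n K)

/-- The left ideal of `U(𝒢'_A ⊕ h'')` generated by `N⁺_A` and all `y - ψ(y)`, `y ∈ H`. -/
def vermaIdeal {n : ℕ} {K : R.Complement} (ψ : Module.Dual ℂ (loopCartan n K)) :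
    Submodule (Env n K) (Env n K) :=
  Submodule.span (Env n K)
    ({u | ∃ y ∈ loopPos n K, u = UniversalEnvelopingAlgebra.ι ℂ y} ∪
     {u | ∃ y : loopCartan n K,
        u = UniversalEnvelopingAlgebra.ι ℂ (y : loopAlg n K)
          - algebraMap ℂ (Env n K) (ψ y)})

/-- The induced module `M(ψ) = U(𝒢'_A ⊕ h'') ⊗_{B'} ℂ(ψ)`, `B' = N⁺_A ⊕ H`, in its cyclic
presentation: `U(B')` acts on the line `ℂ(ψ)` with `N⁺_A` acting by `0` and `H` by `ψ`, so
inducing amounts to dividing `U(𝒢'_A ⊕ h'')` by the left ideal `vermaIdeal ψ`. -/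
abbrev Verma {n : ℕ} {K : R.Complement} (ψ : Module.Dual ℂ (loopCartan n K)) : Type _ :=
  Env n K ⧸ vermaIdeal ψ

/-- The largest proper submodule of `M(ψ)`, as the sum of all proper submodules. -/
def maxSub {n : ℕ} {K : R.Complement} (ψ : Module.Dual ℂ (loopCartan n K)) :
    Submodule (Env n K) (Verma ψ) :=
  sSup {N | N ≠ ⊤}

/-- The irreducible highest weight module `V(ψ)`. -/
abbrev IrrMod {n : ℕ} {K : R.Complement} (ψ : Module.Dual ℂ (loopCartan n K)) : Type _ :=
  Verma ψ ⧸ maxSub ψ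

/-- The weight space `{v ∈ V(ψ) | x v = μ(x) v for all x ∈ h}`. -/
def weightSpace {n : ℕ} {K : R.Complement} (ψ : Module.Dual ℂ (loopCartan n K))
    (μ : Module.Dual ℂ R.cartan) : Submodule ℂ (IrrMod ψ) where
  carrier := {v | ∀ x : R.cartan,
    UniversalEnvelopingAlgebra.ι ℂ (cartanOne n K x) • v = μ x • v}
  add_mem' := fun {v w} hv hw x => by rw [smul_add, smul_add, hv x, hw x]
  zero_mem' := fun x => by rw [smul_zero, smul_zero]
  smul_mem' := fun c v hv x => by
    rw [smul_comm (μ x) c v, ← hv x, ← algebraMap_smul (Env n K) c v,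
      ← algebraMap_smul (Env n K) c (_ • v), smul_smul, smul_smul, Algebra.commutes]

/-- All weight spaces of `V(ψ)` with respect to `h` are finite dimensional. -/
def HasFinDimWeightSpaces {n : ℕ} {K : R.Complement}
    (ψ : Module.Dual ℂ (loopCartan n K)) : Prop :=
  ∀ μ : Module.Dual ℂ R.cartan, FiniteDimensional ℂ (weightSpace ψ μ)

/-- The restriction of `ψ` to `h' ⊗ A` factors through `h' ⊗ A/I`. -/
def FactorsThrough {n : ℕ} {K : R.Complement} (ψ : Module.Dual ℂ (loopCartan n K))
    (I : Ideal (Laurent n)) : Prop :=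
  ∃ χ : ((Laurent n ⧸ I) ⊗[ℂ] R.cartan') →ₗ[ℂ] ℂ,
    ∀ (a : Laurent n) (x : R.cartan'),
      ψ (cartanTmul K a x) = χ (Ideal.Quotient.mk I a ⊗ₜ[ℂ] x)

/-- `𝒢' ⊗ I` acts by zero on `V(ψ)`. -/
def ActsByZero {n : ℕ} {K : R.Complement} (ψ : Module.Dual ℂ (loopCartan n K))
    (I : Ideal (Laurent n)) : Prop :=
  ∀ y : loopAlg n K,
    (y : Laurent n ⊗[ℂ] R.Alg) ∈
      tensorSub (I.restrictScalars ℂ) (LieSubmodule.toSubmodule R.derived) →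
    ∀ v : IrrMod ψ, UniversalEnvelopingAlgebra.ι ℂ y • v = 0

end Loop

end LoopKacMoody

end

/-! Everything rests on one grading. Choose `ρ` in 𝔥 with α_i(ρ) = 1 for all i. Under 1 ⊗ ρ the
algebra N⁻_A has degrees -1, -2, …, H has degree 0 and N⁺_A has degrees 1, 2, …. A module generated
by a highest weight vector v is spanned by words in the a ⊗ f_i applied to v (`wordSubmodule`), so v
spans the top degree, and a proper submodule lies strictly below it (`le_degPart_below`). Hence the
sum of all proper submodules is proper as soon as M(ψ) ≠ 0 (`irrMod_top_ne_zero`). That M(ψ) ≠ 0 is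
obtained without the Poincaré–Birkhoff–Witt theorem: `exists_not_mem_leftIdeal` lets L = a ⊕ b act
on U(a) so that b acts on 1 through a character.

If ψ factors through I, then (𝒢' ⊗ I)v is stable under the Borel subalgebra and lies below the top
degree: N⁺ ⊗ I kills v, h' ⊗ I acts on v by ψ = 0, and N⁻ ⊗ I lowers degrees. It generates a proper
submodule, which vanishes by irreducibility. The vectors killed by the ideal 𝒢' ⊗ I form a submodule
containing v, hence everything (`actsByZero`). If I is also cofinite, the a ⊗ f_i act through a
finite dimensional space of operators, so words of a fixed length span a finite dimensional space,
and each weight space lies in such a span (`hasFinDimWeightSpaces`).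

Conversely, let I be the set of a with (a ⊗ f_i)v = 0 for all i. Acting with b ⊗ α_i^∨ shows that I
is an ideal. It is cofinite because A/I embeds into the finite product of the weight spaces of
weight ψ|_h - α_i. Acting with 1 ⊗ e_i gives ψ(a ⊗ α_i^∨) = 0 for a in I, and the coroots span h'
(`exists_cofinite`). -/

noncomputable section

namespace LoopKacMoody

/-! ### Generation and induction in universal enveloping algebras. -/

section Enveloping

variable {R L : Type*} [CommRing R] [LieRing L] [LieAlgebra R L]

/-- The universal property gives a map U(L) → S whose composite with the inclusion fixes `ι`, hence
is the identity. -/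
theorem envelopingSubalgebra_eq_top (S : Subalgebra R (UniversalEnvelopingAlgebra R L))
    (h : ∀ x, UniversalEnvelopingAlgebra.ι R x ∈ S) : S = ⊤ := by
  let _ := LieRing.ofAssociativeRing (A := S)
  let _ := LieRing.ofAssociativeRing (A := UniversalEnvelopingAlgebra R L)
  let _ := LieAlgebra.ofAssociativeAlgebra (A := S) (R := R)
  let _ := LieAlgebra.ofAssociativeAlgebra (A := UniversalEnvelopingAlgebra R L) (R := R)
  let g : L →ₗ⁅R⁆ S :=
    { toLinearMap := (UniversalEnvelopingAlgebra.ι R : L →ₗ⁅R⁆ _).toLinearMap.codRestrict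
        (Subalgebra.toSubmodule S) h
      map_lie' := by
        intro x y
        apply Subtype.ext
        exact (UniversalEnvelopingAlgebra.ι R : L →ₗ⁅R⁆ _).map_lie x y }
  have key : S.val.comp (UniversalEnvelopingAlgebra.lift R g) = AlgHom.id R _ := by
    apply UniversalEnvelopingAlgebra.hom_ext
    ext x
    change ((UniversalEnvelopingAlgebra.lift R g (UniversalEnvelopingAlgebra.ι R x) : S) :
      UniversalEnvelopingAlgebra R L) = UniversalEnvelopingAlgebra.ι R x
    rw [UniversalEnvelopingAlgebra.lift_ι_apply]
    rfl
  refine eq_top_iff.2 fun u _ => ?_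
  have := congrArg (fun φ : UniversalEnvelopingAlgebra R L →ₐ[R] _ => φ u) key
  change ((UniversalEnvelopingAlgebra.lift R g u : S) : UniversalEnvelopingAlgebra R L) = u at this
  rw [← this]
  exact SetLike.coe_mem _

/-- A subspace of a `U(L)`-module which is stable under `L` is stable under `U(L)`. -/
theorem enveloping_smul_mem {X : Type*} [AddCommGroup X] [Module R X]
    [Module (UniversalEnvelopingAlgebra R L) X] [IsScalarTower R (UniversalEnvelopingAlgebra R L) X]
    (S : Submodule R X) (h : ∀ (x : L), ∀ w ∈ S, UniversalEnvelopingAlgebra.ι R x • w ∈ S)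
    (u : UniversalEnvelopingAlgebra R L) {w : X} (hw : w ∈ S) : u • w ∈ S := by
  let T : Subalgebra R (UniversalEnvelopingAlgebra R L) :=
    { carrier := {u | ∀ w ∈ S, u • w ∈ S}
      mul_mem' := fun {a b} ha hb w hw => by rw [mul_smul]; exact ha _ (hb _ hw)
      add_mem' := fun {a b} ha hb w hw => by rw [add_smul]; exact add_mem (ha _ hw) (hb _ hw)
      algebraMap_mem' := fun r w hw => by
        rw [algebraMap_smul]; exact S.smul_mem r hw }
  have hT : T = ⊤ := envelopingSubalgebra_eq_top T fun x => h x
  have : u ∈ T := hT ▸ Algebra.mem_top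
  exact this w hw

/-- Induction for the universal enveloping algebra with left multiplications. -/
theorem enveloping_induction {p : UniversalEnvelopingAlgebra R L → Prop} (one : p 1)
    (add : ∀ u w, p u → p w → p (u + w)) (smul : ∀ (r : R) u, p u → p (r • u))
    (mul : ∀ x u, p u → p (UniversalEnvelopingAlgebra.ι R x * u))
    (u : UniversalEnvelopingAlgebra R L) : p u := by
  let S : Submodule R (UniversalEnvelopingAlgebra R L) :=
    { carrier := {u | p u}
      add_mem' := fun {a b} ha hb => add a b ha hb
      zero_mem' := by
        have := smul 0 1 one
        rwa [zero_smul] at this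
      smul_mem' := fun r u hu => smul r u hu }
  have := enveloping_smul_mem S (fun x w hw => mul x w hw) u (w := 1) one
  rwa [smul_eq_mul, mul_one] at this

end Enveloping

/-! ### Induced modules for L = a ⊕ b, realized on U(a). -/

section Induced

attribute [local instance] LieRing.ofAssociativeRing LieAlgebra.ofAssociativeAlgebra

variable {k L : Type*} [CommRing k] [LieRing L] [LieAlgebra k L] (a : LieSubalgebra k L)

/-- The action of `a` on linear maps `L → U(a)`, where `a` acts on `L` by the adjoint action and
on `U(a)` by left multiplication. -/
def homAction : a →ₗ⁅k⁆ Module.End k (L →ₗ[k] UniversalEnvelopingAlgebra k a) where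
  toFun x :=
    { toFun := fun F =>
        { toFun := fun y => UniversalEnvelopingAlgebra.ι k x * F y + F ⁅y, (x : L)⁆
          map_add' := fun y z => by rw [map_add, mul_add, add_lie, map_add]; abel
          map_smul' := fun r y => by
            rw [map_smul, mul_smul_comm, smul_lie, map_smul, smul_add, RingHom.id_apply] }
      map_add' := fun F G => by
        ext y
        simp only [LinearMap.coe_mk, AddHom.coe_mk, LinearMap.add_apply, mul_add]
        abel
      map_smul' := fun r F => by
        ext y
        simp }
  map_add' x z := by
    ext F y
    simp only [LinearMap.coe_mk, AddHom.coe_mk, LinearMap.add_apply, map_add, add_mul,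
      show ((x + z : a) : L) = x + z from rfl, lie_add]
    abel
  map_smul' r x := by
    ext F y
    simp
  map_lie' {x z} := by
    ext F y
    simp only [LieRing.of_associative_ring_bracket, LinearMap.coe_mk, AddHom.coe_mk,
      LinearMap.sub_apply, Module.End.mul_apply, LieHom.map_lie, LieSubalgebra.coe_bracket]
    have h : ⁅y, ⁅(x : L), (z : L)⁆⁆ = ⁅⁅y, (x : L)⁆, (z : L)⁆ - ⁅⁅y, (z : L)⁆, (x : L)⁆ := by
      rw [leibniz_lie y (x : L) (z : L), ← lie_skew ⁅y, (z : L)⁆ (x : L)]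
      abel
    rw [h, map_sub]
    noncomm_ring

theorem homAction_apply (x : a) (F : L →ₗ[k] UniversalEnvelopingAlgebra k a) (y : L) :
    homAction a x F y = UniversalEnvelopingAlgebra.ι k x * F y + F ⁅y, (x : L)⁆ := rfl

/-- The operator on `U(a)` of an element of `L`, determined by its value `F₀` at `1`. -/
def inducedAct (F₀ : L →ₗ[k] UniversalEnvelopingAlgebra k a) :
    L →ₗ[k] Module.End k (UniversalEnvelopingAlgebra k a) :=
  LinearMap.flip ((LinearMap.applyₗ F₀).comp
    (UniversalEnvelopingAlgebra.lift k (homAction a)).toLinearMap)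

variable (F₀ : L →ₗ[k] UniversalEnvelopingAlgebra k a)

theorem inducedAct_one (y : L) : inducedAct a F₀ y 1 = F₀ y := by
  simp [inducedAct]

/-- This is the forced rule y(xu) = x(yu) + [y, x]u. It is consistent because `homAction` is a Lie
homomorphism and so extends to U(a). -/
theorem inducedAct_mul (y : L) (x : a) (u : UniversalEnvelopingAlgebra k a) :
    inducedAct a F₀ y (UniversalEnvelopingAlgebra.ι k x * u) =
      UniversalEnvelopingAlgebra.ι k x * inducedAct a F₀ y u + inducedAct a F₀ ⁅y, (x : L)⁆ u := by
  simp only [inducedAct, LinearMap.flip_apply, LinearMap.comp_apply, AlgHom.toLinearMap_apply,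
    map_mul, UniversalEnvelopingAlgebra.lift_ι_apply, LinearMap.applyₗ_apply_apply,
    Module.End.mul_apply, homAction_apply]

theorem inducedAct_coe (hF : ∀ x : a, F₀ x = UniversalEnvelopingAlgebra.ι k x) (x : a)
    (u : UniversalEnvelopingAlgebra k a) :
    inducedAct a F₀ x u = UniversalEnvelopingAlgebra.ι k x * u := by
  induction u using enveloping_induction generalizing x with
  | one => rw [inducedAct_one, hF, mul_one]
  | add u w hu hw => rw [map_add, hu, hw, mul_add]
  | smul r u hu => rw [map_smul, hu, mul_smul_comm]
  | mul z u hu =>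
    rw [inducedAct_mul, hu, ← LieSubalgebra.coe_bracket, hu, LieHom.map_lie,
      LieRing.of_associative_ring_bracket]
    noncomm_ring

/-- The Jacobi identity propagates the bracket relation from u to xu, so only the vector 1 has to be
checked. The induction needs the relation for all pairs at once, since y and z get replaced by their
brackets with x. -/
theorem inducedAct_lie
    (h1 : ∀ y z : L, inducedAct a F₀ ⁅y, z⁆ 1 =
      inducedAct a F₀ y (F₀ z) - inducedAct a F₀ z (F₀ y))
    (y z : L) (u : UniversalEnvelopingAlgebra k a) :
    inducedAct a F₀ ⁅y, z⁆ u =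
      inducedAct a F₀ y (inducedAct a F₀ z u) - inducedAct a F₀ z (inducedAct a F₀ y u) := by
  induction u using enveloping_induction generalizing y z with
  | one => rw [h1, inducedAct_one, inducedAct_one]
  | add u w hu hw => simp only [map_add, hu, hw]; abel
  | smul r u hu => simp only [map_smul, hu, smul_sub]
  | mul x u hu =>
    have h : ⁅⁅y, z⁆, (x : L)⁆ = ⁅y, ⁅z, (x : L)⁆⁆ - ⁅z, ⁅y, (x : L)⁆⁆ := by
      rw [leibniz_lie y z (x : L)]; abel
    simp only [inducedAct_mul, map_add, hu, h, map_sub, LinearMap.sub_apply]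
    noncomm_ring

/-- If `L = a ⊕ b` for subalgebras `a` and `b`, and `lam` is a character of `b`, then the left ideal
of `U(L)` generated by all `y - lam y`, `y ∈ b`, is proper. -/
theorem exists_not_mem_leftIdeal {k L : Type*} [Field k] [LieRing L] [LieAlgebra k L]
    (a : LieSubalgebra k L) (b : Submodule k L)
    (hab : IsCompl a.toSubmodule b) (hb : ∀ y ∈ b, ∀ z ∈ b, ⁅y, z⁆ ∈ b) (lam : L →ₗ[k] k)
    (hlam : ∀ y ∈ b, ∀ z ∈ b, lam ⁅y, z⁆ = 0) :
    (1 : UniversalEnvelopingAlgebra k L) ∉ Submodule.span (UniversalEnvelopingAlgebra k L)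
      {u | ∃ y ∈ b, u = UniversalEnvelopingAlgebra.ι k y -
        algebraMap k (UniversalEnvelopingAlgebra k L) (lam y)} := by
  -- The value on 1 is dictated by the desired module: a acts by left multiplication and b through
  -- `lam`.
  let F₀ : L →ₗ[k] UniversalEnvelopingAlgebra k a :=
    (UniversalEnvelopingAlgebra.ι k : a →ₗ⁅k⁆ _).toLinearMap ∘ₗ
        a.toSubmodule.projectionOnto b hab +
      (Algebra.linearMap k _) ∘ₗ lam ∘ₗ b.subtype ∘ₗ b.projectionOnto a.toSubmodule hab.symm
  have hFa : ∀ x : a, F₀ x = UniversalEnvelopingAlgebra.ι k x := by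
    intro x
    have h1 : a.toSubmodule.projectionOnto b hab (x : L) = x :=
      Submodule.projectionOnto_apply_left hab x
    have h2 : b.projectionOnto a.toSubmodule hab.symm (x : L) = 0 :=
      Submodule.projectionOnto_apply_right hab.symm x
    simp only [F₀, LinearMap.add_apply, LinearMap.comp_apply, h1, h2]
    simp
  have hFb : ∀ y ∈ b, F₀ y = lam y • 1 := by
    intro y hy
    have h1 : a.toSubmodule.projectionOnto b hab y = 0 :=
      Submodule.projectionOnto_apply_right hab ⟨y, hy⟩
    have h2 : b.projectionOnto a.toSubmodule hab.symm y = ⟨y, hy⟩ :=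
      Submodule.projectionOnto_apply_left hab.symm ⟨y, hy⟩
    simp only [F₀, LinearMap.add_apply, LinearMap.comp_apply, h1, h2]
    simp [Algebra.algebraMap_eq_smul_one]
  let Q : L → L → Prop := fun y z => inducedAct a F₀ ⁅y, z⁆ 1 =
      inducedAct a F₀ y (F₀ z) - inducedAct a F₀ z (F₀ y)
  have hQa : ∀ y, ∀ z : a, Q y z := by
    intro y z
    change _ = _
    have h := inducedAct_mul a F₀ y z 1
    rw [mul_one, inducedAct_one] at h
    rw [inducedAct_coe a F₀ hFa, hFa, h]
    abel
  have hQa' : ∀ y : a, ∀ z, Q y z := by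
    intro y z
    have h : _ = _ := hQa z y
    change _ = _
    rw [← lie_skew, map_neg, LinearMap.neg_apply, h]
    abel
  have hQb : ∀ y ∈ b, ∀ z ∈ b, Q y z := by
    intro y hy z hz
    change _ = _
    rw [inducedAct_one, hFb _ (hb y hy z hz), hlam y hy z hz, hFb y hy, hFb z hz, map_smul,
      map_smul, inducedAct_one, inducedAct_one, hFb y hy, hFb z hz, smul_comm, zero_smul, sub_self]
  -- The relation is biadditive, so the cases with an entry in a and the case b × b, where `lam`
  -- kills brackets, suffice.
  have hQ : ∀ y z, Q y z := by
    intro y z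
    have hsplit : ∀ x : L, ∃ x₁ : a, ∃ x₂ ∈ b, x = x₁ + x₂ := by
      intro x
      obtain ⟨x₁, h₁, x₂, h₂, rfl⟩ :=
        Submodule.mem_sup.1 (hab.sup_eq_top ▸ Submodule.mem_top : x ∈ a.toSubmodule ⊔ b)
      exact ⟨⟨x₁, h₁⟩, x₂, h₂, rfl⟩
    obtain ⟨y₁, y₂, hy₂, rfl⟩ := hsplit y
    obtain ⟨z₁, z₂, hz₂, rfl⟩ := hsplit z
    have e1 : _ = _ := hQa' y₁ (z₁ + z₂)
    have e2 : _ = _ := hQa y₂ z₁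
    have e3 : _ = _ := hQb y₂ hy₂ z₂ hz₂
    change _ = _
    simp only [lie_add, add_lie, map_add, LinearMap.add_apply] at e1 e2 e3 ⊢
    rw [e2, e3, add_add_add_comm, e1]
    abel
  let ρ : L →ₗ⁅k⁆ Module.End k (UniversalEnvelopingAlgebra k a) :=
    { toLinearMap := inducedAct a F₀
      map_lie' := by
        intro y z
        ext u
        exact inducedAct_lie a F₀ hQ y z u }
  -- `J` is the annihilator of the vector 1 of U(a). It contains the generators of the left ideal,
  -- but not 1.
  let J : Submodule (UniversalEnvelopingAlgebra k L) (UniversalEnvelopingAlgebra k L) :=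
    { carrier := {u | UniversalEnvelopingAlgebra.lift k ρ u 1 = 0}
      add_mem' := fun {u w} hu hw => by
        simp only [Set.mem_ofPred_eq] at hu hw ⊢
        rw [map_add, LinearMap.add_apply, hu, hw, add_zero]
      zero_mem' := by simp
      smul_mem' := fun u w hw => by
        simp only [Set.mem_ofPred_eq] at hw ⊢
        rw [smul_eq_mul, map_mul, Module.End.mul_apply, hw, map_zero] }
  intro hmem
  have hJ : (1 : UniversalEnvelopingAlgebra k L) ∈ J := by
    refine Submodule.span_le.2 ?_ hmem
    rintro u ⟨y, hy, rfl⟩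
    change UniversalEnvelopingAlgebra.lift k ρ _ 1 = 0
    rw [map_sub, UniversalEnvelopingAlgebra.lift_ι_apply, AlgHom.commutes, LinearMap.sub_apply,
      Module.algebraMap_end_apply, sub_eq_zero]
    exact (inducedAct_one a F₀ y).trans (hFb y hy)
  have h10 : (1 : UniversalEnvelopingAlgebra k a) = 0 := by
    have : UniversalEnvelopingAlgebra.lift k ρ 1 1 = 0 := hJ
    have h1 : UniversalEnvelopingAlgebra.lift k ρ 1 = 1 := map_one _
    rwa [h1, Module.End.one_apply] at this
  -- The augmentation U(a) → k shows 1 ≠ 0 in U(a).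
  have h11 := congrArg (UniversalEnvelopingAlgebra.lift k (0 : a →ₗ⁅k⁆ k)) h10
  rw [map_one, map_zero] at h11
  exact one_ne_zero h11

end Induced

/-! ### Gradings by eigenvalues and spans of words. -/

section Degree

variable {k : Type*} [Field k]

/-- The sum of the eigenspaces of `D` with eigenvalues in `s`. -/
def degPart {X : Type*} [AddCommGroup X] [Module k X] (D : Module.End k X) (s : Set k) :
    Submodule k X :=
  ⨆ μ ∈ s, D.eigenspace μ

section

variable {X : Type*} [AddCommGroup X] [Module k X] {D : Module.End k X}

theorem mem_degPart {s : Set k} {μ : k} (hμ : μ ∈ s) {x : X} (hx : D x = μ • x) :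
    x ∈ degPart D s :=
  (le_iSup₂ (f := fun μ (_ : μ ∈ s) => D.eigenspace μ) μ hμ) (Module.End.mem_eigenspace_iff.2 hx)

theorem degPart_le {s : Set k} {S : Submodule k X}
    (h : ∀ μ ∈ s, ∀ x, D x = μ • x → x ∈ S) : degPart D s ≤ S :=
  iSup₂_le fun μ hμ x hx => h μ hμ x (Module.End.mem_eigenspace_iff.1 hx)

theorem degPart_mono {s t : Set k} (h : s ⊆ t) : degPart D s ≤ degPart D t :=
  biSup_mono fun _ hμ => h hμ

theorem degPart_disjoint {s t : Set k} (h : Disjoint s t) :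
    Disjoint (degPart D s) (degPart D t) := by
  have hind : iSupIndep D.eigenspace := D.eigenspaces_iSupIndep
  unfold degPart
  exact hind.disjoint_biSup_biSup h

theorem degPart_singleton {μ : k} {x : X} : x ∈ degPart D {μ} ↔ D x = μ • x := by
  refine ⟨fun h => ?_, fun h => mem_degPart (Set.mem_singleton μ) h⟩
  have : degPart D {μ} ≤ D.eigenspace μ := degPart_le fun ν hν x hx => by
    rw [Set.mem_singleton_iff] at hν
    exact Module.End.mem_eigenspace_iff.2 (hν ▸ hx)
  exact Module.End.mem_eigenspace_iff.1 (this h)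

/-- Applying D - ν removes the ν-summand and rescales every other one by the nonzero scalar μ - ν,
so induction on the number of summands applies. -/
theorem eigenvector_mem_of_sum_mem {N : Submodule k X} (hN : ∀ w ∈ N, D w ∈ N) (s : Finset k)
    (x : k → X) (hx : ∀ μ ∈ s, D (x μ) = μ • x μ) (hs : ∑ μ ∈ s, x μ ∈ N) :
    ∀ μ ∈ s, x μ ∈ N := by
  classical
  induction s using Finset.induction_on generalizing x with
  | empty => simp
  | insert ν s hν ih =>
    rw [Finset.sum_insert hν] at hs
    have h1 : ∑ μ ∈ s, (μ - ν) • x μ ∈ N := by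
      have := sub_mem (hN _ hs) (N.smul_mem ν hs)
      rw [map_add, map_sum, hx ν (Finset.mem_insert_self _ _), smul_add, add_sub_add_left_eq_sub,
        Finset.smul_sum, ← Finset.sum_sub_distrib] at this
      convert this using 1
      refine Finset.sum_congr rfl fun μ hμ => ?_
      rw [hx μ (Finset.mem_insert_of_mem hμ), sub_smul]
    have h2 := ih (fun μ => (μ - ν) • x μ) (fun μ hμ => by
      rw [map_smul, hx μ (Finset.mem_insert_of_mem hμ), smul_comm]) h1
    have h3 : ∀ μ ∈ s, x μ ∈ N := fun μ hμ => by
      have hne : μ - ν ≠ 0 := sub_ne_zero.2 fun h => hν (h ▸ hμ)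
      have := N.smul_mem (μ - ν)⁻¹ (h2 μ hμ)
      rwa [smul_smul, inv_mul_cancel₀ hne, one_smul] at this
    intro μ hμ
    rcases Finset.mem_insert.1 hμ with rfl | hμ
    · exact (add_mem_cancel_right (sum_mem h3)).1 hs
    · exact h3 μ hμ

theorem eq_iSup_inf_eigenspace {N : Submodule k X} (hN : ∀ w ∈ N, D w ∈ N)
    (h : (⨆ μ, D.eigenspace μ) = ⊤) : N = ⨆ μ, N ⊓ D.eigenspace μ := by
  refine le_antisymm (fun w hw => ?_) (iSup_le fun μ => inf_le_left)
  obtain ⟨x, hx, rfl⟩ := (Submodule.mem_iSup_iff_exists_finsupp _ w).1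
    (h ▸ Submodule.mem_top : w ∈ ⨆ μ, D.eigenspace μ)
  have hmem := eigenvector_mem_of_sum_mem hN x.support x
    (fun μ _ => Module.End.mem_eigenspace_iff.1 (hx μ)) hw
  exact sum_mem fun μ hμ => le_iSup (fun μ => N ⊓ D.eigenspace μ) μ ⟨hmem μ hμ, hx μ⟩

end

variable {L : Type*} [LieRing L] [LieAlgebra k L] {X : Type*} [AddCommGroup X] [Module k X]
  [LieRingModule L X] [LieModule k L X]

/-- By the Leibniz rule for d, eigenvalues add under the action. The case X = L grades L itself. -/
theorem lie_mem_degPart {d : L} {s t r : Set k} (h : ∀ a ∈ s, ∀ b ∈ t, a + b ∈ r) {x : L} {w : X}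
    (hx : x ∈ degPart (LieModule.toEnd k L L d) s) (hw : w ∈ degPart (LieModule.toEnd k L X d) t) :
    ⁅x, w⁆ ∈ degPart (LieModule.toEnd k L X d) r := by
  have h1 : degPart (LieModule.toEnd k L L d) s ≤ (degPart (LieModule.toEnd k L X d) r).comap
      ((LieModule.toEnd k L X : L →ₗ[k] Module.End k X).flip w) := by
    refine degPart_le fun a ha y hy => ?_
    change ⁅y, w⁆ ∈ degPart (LieModule.toEnd k L X d) r
    have h2 : degPart (LieModule.toEnd k L X d) t ≤ (degPart (LieModule.toEnd k L X d) r).comap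
        (LieModule.toEnd k L X y) := by
      refine degPart_le fun b hb z hz => ?_
      change ⁅y, z⁆ ∈ degPart (LieModule.toEnd k L X d) r
      refine mem_degPart (h a ha b hb) ?_
      rw [LieModule.toEnd_apply_apply] at hy hz ⊢
      rw [leibniz_lie, hy, hz, smul_lie, lie_smul, add_smul]
    exact h2 hw
  exact h1 hx

/-- The subspaces obtained from `W` by applying words in `F` of a given length. -/
def wordSpace (F : Submodule k L) (W : Submodule k X) : ℕ → Submodule k X
  | 0 => W
  | m + 1 => Submodule.map₂ (LieModule.toEnd k L X : L →ₗ[k] Module.End k X) F (wordSpace F W m)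

theorem lie_mem_wordSpace_succ {F : Submodule k L} {W : Submodule k X} {m : ℕ} {y : L} {w : X}
    (hy : y ∈ F) (hw : w ∈ wordSpace F W m) : ⁅y, w⁆ ∈ wordSpace F W (m + 1) :=
  Submodule.apply_mem_map₂ (LieModule.toEnd k L X : L →ₗ[k] Module.End k X) hy hw

theorem wordSpace_lie_left {F : Submodule k L} {W : Submodule k X} {y : L} (hy : y ∈ F) {w : X}
    (hw : w ∈ ⨆ m, wordSpace F W m) : ⁅y, w⁆ ∈ ⨆ m, wordSpace F W m := by
  have : (⨆ m, wordSpace F W m) ≤ (⨆ m, wordSpace F W m).comap (LieModule.toEnd k L X y) :=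
    iSup_le fun m z hz => le_iSup (wordSpace F W) (m + 1) (lie_mem_wordSpace_succ hy hz)
  exact this hw

/-- An element b is commuted past the first letter of a word. The bracket has an F-part, which is
again a letter, and a B-part, which acts on a shorter word and is covered by induction. -/
theorem wordSpace_lie_right {F B : Submodule k L} {W : Submodule k X}
    (hW : ∀ b ∈ B, ∀ w ∈ W, ⁅b, w⁆ ∈ W) (hBF : ∀ b ∈ B, ∀ y ∈ F, ⁅b, y⁆ ∈ F ⊔ B) (m : ℕ) :
    ∀ b ∈ B, ∀ w ∈ wordSpace F W m, ⁅b, w⁆ ∈ ⨆ m, wordSpace F W m := by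
  induction m with
  | zero => exact fun b hb w hw => le_iSup (wordSpace F W) 0 (hW b hb w hw)
  | succ m ih =>
    intro b hb w hw
    have : wordSpace F W (m + 1) ≤ (⨆ m, wordSpace F W m).comap (LieModule.toEnd k L X b) := by
      refine Submodule.map₂_le.2 fun y hy z hz => ?_
      change ⁅b, ⁅y, z⁆⁆ ∈ ⨆ m, wordSpace F W m
      rw [leibniz_lie]
      refine add_mem ?_ (wordSpace_lie_left hy (ih b hb z hz))
      obtain ⟨y', hy', b', hb', h⟩ := Submodule.mem_sup.1 (hBF b hb y hy)
      rw [← h, add_lie]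
      exact add_mem (wordSpace_lie_left hy' (le_iSup (wordSpace F W) m hz)) (ih b' hb' z hz)
    exact this hw

/-- The submodule generated by a `B`-stable subspace `W` is spanned by words in `F` applied to
`W`. -/
def wordSubmodule (F B : Submodule k L) (W : Submodule k X)
    (hW : ∀ b ∈ B, ∀ w ∈ W, ⁅b, w⁆ ∈ W) (hBF : ∀ b ∈ B, ∀ y ∈ F, ⁅b, y⁆ ∈ F ⊔ B)
    (hgen : LieSubalgebra.lieSpan k L ((F : Set L) ∪ B) = ⊤) : LieSubmodule k L X where
  toSubmodule := ⨆ m, wordSpace F W m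
  lie_mem := by
    intro x w hw
    let T : LieSubalgebra k L :=
      { carrier := {x | ∀ w ∈ ⨆ m, wordSpace F W m, ⁅x, w⁆ ∈ ⨆ m, wordSpace F W m}
        add_mem' := fun hx hy w hw => by rw [add_lie]; exact add_mem (hx w hw) (hy w hw)
        zero_mem' := fun w _ => by rw [zero_lie]; exact zero_mem _
        smul_mem' := fun c x hx w hw => by rw [smul_lie]; exact Submodule.smul_mem _ _ (hx w hw)
        lie_mem' := fun hx hy w hw => by
          rw [lie_lie]; exact sub_mem (hx _ (hy w hw)) (hy _ (hx w hw)) }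
    have hT : (⊤ : LieSubalgebra k L) ≤ T := by
      rw [← hgen, LieSubalgebra.lieSpan_le]
      rintro y (hy | hy) w hw
      · exact wordSpace_lie_left hy hw
      · have : (⨆ m, wordSpace F W m) ≤ (⨆ m, wordSpace F W m).comap (LieModule.toEnd k L X y) :=
          iSup_le fun m z hz => wordSpace_lie_right hW hBF m y hy z hz
        exact this hw
    exact hT (LieSubalgebra.mem_top x) w hw

/-- The numbers `c - 1, c - 2, …`. -/
def below (c : k) : Set k := {z | ∃ m : ℕ, z = c - (m + 1)}

theorem not_mem_below [CharZero k] (c : k) : c ∉ below c := by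
  rintro ⟨m, hm⟩
  have : (m : k) + 1 = 0 := by linear_combination hm
  exact Nat.cast_add_one_ne_zero m this

theorem wordSpace_le_degPart {d : L} {F : Submodule k L} {W : Submodule k X} {c : k}
    (hF : ∀ y ∈ F, ⁅d, y⁆ = -y) (hW : ∀ w ∈ W, ⁅d, w⁆ = c • w) (m : ℕ) :
    wordSpace F W m ≤ degPart (LieModule.toEnd k L X d) {c - m} := by
  induction m with
  | zero =>
    intro w hw
    rw [degPart_singleton, Nat.cast_zero, sub_zero]
    exact hW w hw
  | succ m ih =>
    refine Submodule.map₂_le.2 fun y hy z hz => ?_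
    refine lie_mem_degPart (s := {-1}) (t := {c - m}) ?_ ?_ (ih hz)
    · rintro _ rfl _ rfl
      rw [Set.mem_singleton_iff]
      push_cast
      ring
    · rw [degPart_singleton, LieModule.toEnd_apply_apply, hF y hy, neg_smul, one_smul]

theorem wordSpace_le_degPart_below {d : L} {F : Submodule k L} {W : Submodule k X} {c : k}
    (hF : ∀ y ∈ F, ⁅d, y⁆ = -y) (hW : W ≤ degPart (LieModule.toEnd k L X d) (below c)) (m : ℕ) :
    wordSpace F W m ≤ degPart (LieModule.toEnd k L X d) (below c) := by
  induction m with
  | zero => exact hW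
  | succ m ih =>
    refine Submodule.map₂_le.2 fun y hy z hz => ?_
    refine lie_mem_degPart (s := {-1}) (t := below c) ?_ ?_ (ih hz)
    · rintro _ rfl _ ⟨j, rfl⟩
      refine ⟨j + 1, ?_⟩
      push_cast
      ring
    · rw [degPart_singleton, LieModule.toEnd_apply_apply, hF y hy, neg_smul, one_smul]

/-- If the words in `F` applied to `v` span `X`, then an invariant subspace without `v` lies
strictly below the top degree. -/
theorem le_degPart_below [CharZero k] {d : L} {F : Submodule k L} {v : X} {c : k}
    (hF : ∀ y ∈ F, ⁅d, y⁆ = -y) (hv : ⁅d, v⁆ = c • v)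
    (htop : (⨆ m, wordSpace F (k ∙ v) m) = ⊤) {N : Submodule k X}
    (hN : ∀ w ∈ N, ⁅d, w⁆ ∈ N) (hvN : v ∉ N) :
    N ≤ degPart (LieModule.toEnd k L X d) (below c) := by
  set D := LieModule.toEnd k L X d
  have hkv : ∀ w ∈ (k ∙ v : Submodule k X), ⁅d, w⁆ = c • w := by
    intro w hw
    obtain ⟨a, rfl⟩ := Submodule.mem_span_singleton.1 hw
    rw [lie_smul, hv, smul_comm]
  have hle : ∀ m, wordSpace F (k ∙ v) m ≤ degPart D {c - m} := wordSpace_le_degPart hF hkv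
  -- The empty word gives the line of v; every longer word lowers the degree by at least one.
  have hsplit : (k ∙ v) ⊔ degPart D (below c) = ⊤ := by
    rw [eq_top_iff, ← htop]
    refine iSup_le fun m => ?_
    cases m with
    | zero => exact le_sup_left
    | succ m =>
      refine ((hle (m + 1)).trans (degPart_mono ?_)).trans le_sup_right
      rintro _ rfl
      exact ⟨m, by push_cast; rfl⟩
  have hall : (⨆ μ, D.eigenspace μ) = ⊤ := by
    rw [eq_top_iff, ← htop]
    refine iSup_le fun m => (hle m).trans ?_
    exact degPart_le fun μ _ x hx =>
      (le_iSup D.eigenspace μ) (Module.End.mem_eigenspace_iff.2 hx)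
  have hNe : N = ⨆ μ, N ⊓ D.eigenspace μ :=
    eq_iSup_inf_eigenspace hN hall
  rw [hNe]
  refine iSup_le fun μ w hw => ?_
  have hwN := hw.1
  have hwD : w ∈ degPart D {μ} := degPart_singleton.2 (Module.End.mem_eigenspace_iff.1 hw.2)
  have hwt : w ∈ (k ∙ v) ⊔ degPart D (below c) := by rw [hsplit]; exact Submodule.mem_top
  obtain ⟨z, hz, r, hr, rfl⟩ := Submodule.mem_sup.1 hwt
  have hzc : z ∈ degPart D {c} := degPart_singleton.2 (hkv z hz)
  have hcb : Disjoint {c} (below c) := Set.disjoint_singleton_left.2 (not_mem_below c)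
  -- An eigenvector in N of top degree would be a multiple of v, hence zero; in any other degree the
  -- component along v vanishes.
  by_cases hμ : μ = c
  · subst hμ
    have hr0 : r = 0 := by
      have : r ∈ degPart D {μ} := by simpa using sub_mem hwD hzc
      exact Submodule.disjoint_def.1 (degPart_disjoint hcb) r this hr
    rw [hr0, add_zero] at hwN ⊢
    obtain ⟨a, rfl⟩ := Submodule.mem_span_singleton.1 hz
    by_cases ha : a = 0
    · rw [ha, zero_smul]; exact zero_mem _
    · refine absurd ?_ hvN
      have := N.smul_mem a⁻¹ hwN
      rwa [smul_smul, inv_mul_cancel₀ ha, one_smul] at this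
  · have hz0 : z = 0 := by
      have h1 : z ∈ degPart D ({μ} ∪ below c) := by
        have := sub_mem (degPart_mono (D := D) (Set.subset_union_left (t := below c)) hwD)
          (degPart_mono (D := D) (Set.subset_union_right (s := {μ})) hr)
        simpa using this
      refine Submodule.disjoint_def.1 (degPart_disjoint (D := D) ?_) z hzc h1
      rw [Set.disjoint_union_right]
      exact ⟨Set.disjoint_singleton.2 (Ne.symm hμ), hcb⟩
    rw [hz0, zero_add]
    exact hr

/-- If words in `F` applied to `v` span `X`, an eigenspace is contained in the span of the words
of one fixed length. -/
theorem eigenspace_le_wordSpace [CharZero k] {d : L} {F : Submodule k L} {v : X} {c : k}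
    (hF : ∀ y ∈ F, ⁅d, y⁆ = -y) (hv : ⁅d, v⁆ = c • v)
    (htop : (⨆ m, wordSpace F (k ∙ v) m) = ⊤) (μ : k) :
    ∃ m, (LieModule.toEnd k L X d).eigenspace μ ≤ wordSpace F (k ∙ v) m := by
  set D := LieModule.toEnd k L X d
  have hkv : ∀ w ∈ (k ∙ v : Submodule k X), ⁅d, w⁆ = c • w := by
    intro w hw
    obtain ⟨a, rfl⟩ := Submodule.mem_span_singleton.1 hw
    rw [lie_smul, hv, smul_comm]
  have hle : ∀ m, wordSpace F (k ∙ v) m ≤ degPart D {c - m} := wordSpace_le_degPart hF hkv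
  -- Here m is the only word length that can have eigenvalue μ. If no length has it, the eigenspace
  -- is zero and m = 0 is a mere default.
  obtain ⟨m, hm⟩ : ∃ m : ℕ, ∀ j : ℕ, j ≠ m → μ ≠ c - j := by
    by_cases h : ∃ m : ℕ, μ = c - m
    · obtain ⟨m, rfl⟩ := h
      exact ⟨m, fun j hj he => hj (Nat.cast_injective (R := k) (by linear_combination he))⟩
    · exact ⟨0, fun j _ he => h ⟨j, he⟩⟩
  refine ⟨m, fun w hw => ?_⟩
  have hwD : w ∈ degPart D {μ} := degPart_singleton.2 (Module.End.mem_eigenspace_iff.1 hw)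
  have hsplit : wordSpace F (k ∙ v) m ⊔ degPart D {z | ∃ j : ℕ, j ≠ m ∧ z = c - j} = ⊤ := by
    rw [eq_top_iff, ← htop]
    refine iSup_le fun j => ?_
    by_cases hj : j = m
    · rw [hj]; exact le_sup_left
    · refine ((hle j).trans (degPart_mono ?_)).trans le_sup_right
      rintro _ rfl
      exact ⟨j, hj, rfl⟩
  obtain ⟨z, hz, r, hr, rfl⟩ := Submodule.mem_sup.1
    (hsplit ▸ Submodule.mem_top : w ∈ wordSpace F (k ∙ v) m ⊔ _)
  by_cases hμ : μ = c - m
  · have h1 : r ∈ degPart D {c - (m : k)} := by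
      rw [hμ] at hwD
      simpa using sub_mem hwD (hle m hz)
    have hr0 : r = 0 := by
      refine Submodule.disjoint_def.1 (degPart_disjoint (D := D) ?_) r h1 hr
      rw [Set.disjoint_singleton_left]
      rintro ⟨j, hj, he⟩
      exact hm j hj (hμ.trans he)
    rw [hr0, add_zero]
    exact hz
  · have h1 : z + r ∈ degPart D {z | ∃ j : ℕ, z = c - j} := by
      refine add_mem (degPart_mono ?_ (hle m hz)) (degPart_mono ?_ hr)
      · rintro _ rfl; exact ⟨m, rfl⟩
      · rintro _ ⟨j, _, rfl⟩; exact ⟨j, rfl⟩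
    have h0 : z + r = 0 := by
      refine Submodule.disjoint_def.1 (degPart_disjoint (D := D) ?_) _ hwD h1
      rw [Set.disjoint_singleton_left]
      rintro ⟨j, he⟩
      by_cases hj : j = m
      · exact hμ (hj ▸ he)
      · exact hm j hj he
    rw [h0]
    exact zero_mem _

/-- Words depend only on the operators by which F acts, so F itself may be infinite dimensional, as
happens for A ⊗ f_i. -/
theorem wordSpace_finiteDimensional {F : Submodule k L} {W : Submodule k X}
    (hF : FiniteDimensional k (F.map (LieModule.toEnd k L X : L →ₗ[k] Module.End k X)))
    (hW : FiniteDimensional k W) (m : ℕ) : FiniteDimensional k (wordSpace F W m) := by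
  induction m with
  | zero => exact hW
  | succ m ih =>
    have h : wordSpace F W (m + 1) = Submodule.map₂ (LinearMap.id : Module.End k X →ₗ[k] _)
        (F.map (LieModule.toEnd k L X : L →ₗ[k] Module.End k X)) (wordSpace F W m) := by
      rw [Submodule.map₂_map_left]
      rfl
    rw [h]
    exact Module.Finite.iff_fg.2
      (Submodule.FG.map₂ _ (Module.Finite.iff_fg.1 hF) (Module.Finite.iff_fg.1 ih))

end Degree

/-! ### Triangular decomposition and principal grading of the Kac–Moody algebra. -/

section Structure

variable {ι : Type*} [Fintype ι] {C : Matrix ι ι ℤ}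
  {𝔥 : Type*} [AddCommGroup 𝔥] [Module ℂ 𝔥] (R : Realization C 𝔥)

/-- The projection of the free Lie algebra to the auxiliary Lie algebra. -/
def auxProj : FreeLieAlgebra ℂ (Gen ι 𝔥) →ₗ⁅ℂ⁆ R.Aux where
  toFun x := LieSubmodule.Quotient.mk' R.relIdeal x
  map_add' _ _ := rfl
  map_smul' _ _ := rfl
  map_lie' := rfl

/-- The projection of the auxiliary Lie algebra to the Kac-Moody algebra. -/
def algProj : R.Aux →ₗ⁅ℂ⁆ R.Alg where
  toFun x := LieSubmodule.Quotient.mk' R.radical x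
  map_add' _ _ := rfl
  map_smul' _ _ := rfl
  map_lie' := rfl

/-- The projection of the free Lie algebra to the Kac-Moody algebra. -/
def freeProj : FreeLieAlgebra ℂ (Gen ι 𝔥) →ₗ⁅ℂ⁆ R.Alg := (algProj R).comp (auxProj R)

theorem freeProj_surjective : Function.Surjective (freeProj R) :=
  (LieSubmodule.Quotient.surjective_mk' R.radical).comp
    (LieSubmodule.Quotient.surjective_mk' R.relIdeal)

theorem freeProj_rel {x : FreeLieAlgebra ℂ (Gen ι 𝔥)} (hx : R.IsRel x) : freeProj R x = 0 := by
  have h : auxProj R x = 0 := (LieSubmodule.Quotient.mk_eq_zero').2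
    (LieSubmodule.subset_lieSpan hx)
  rw [freeProj, LieHom.comp_apply, h, map_zero]

/-- A subalgebra which contains the generators is everything. -/
theorem subalgebra_eq_top (S : LieSubalgebra ℂ R.Alg) (h : ∀ g, R.algGen g ∈ S) : S = ⊤ := by
  let φ : FreeLieAlgebra ℂ (Gen ι 𝔥) →ₗ⁅ℂ⁆ S := FreeLieAlgebra.lift ℂ fun g => ⟨R.algGen g, h g⟩
  have hφ : S.incl.comp φ = freeProj R := by
    apply FreeLieAlgebra.hom_ext
    intro g
    rw [LieHom.comp_apply, FreeLieAlgebra.lift_of_apply]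
    rfl
  refine eq_top_iff.2 fun x _ => ?_
  obtain ⟨y, rfl⟩ := freeProj_surjective R x
  rw [← hφ]
  exact (φ y).2

/-- The map `𝔥 → 𝒢`. -/
def cartanMap : 𝔥 →ₗ[ℂ] R.Alg where
  toFun x := R.algGen (.c x)
  map_add' x y := by
    have := freeProj_rel R (.add x y)
    rwa [map_sub, map_add, sub_eq_zero] at this
  map_smul' a x := by
    have := freeProj_rel R (.smul a x)
    rwa [map_sub, map_smul, sub_eq_zero] at this

theorem cartanMap_range : LinearMap.range (cartanMap R) = R.cartan := by
  exact (Submodule.span_eq (LinearMap.range (cartanMap R))).symm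

theorem cartanMap_mem (x : 𝔥) : cartanMap R x ∈ R.cartan := by
  rw [← cartanMap_range]
  exact ⟨x, rfl⟩

/-- The generators `e_i`. -/
abbrev eGen (i : ι) : R.Alg := R.algGen (.e i)

/-- The generators `f_i`. -/
abbrev fGen (i : ι) : R.Alg := R.algGen (.f i)

theorem lie_e_f_same (i : ι) : ⁅eGen R i, fGen R i⁆ = cartanMap R (R.coroot i) := by
  have := freeProj_rel R (.ef_same i)
  rwa [map_sub, sub_eq_zero, LieHom.map_lie] at this

theorem lie_e_f_ne {i j : ι} (h : i ≠ j) : ⁅eGen R i, fGen R j⁆ = 0 := by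
  have := freeProj_rel R (.ef_ne i j h)
  rwa [LieHom.map_lie] at this

theorem lie_cartan_cartan {x y : R.Alg} (hx : x ∈ R.cartan) (hy : y ∈ R.cartan) : ⁅x, y⁆ = 0 := by
  rw [← cartanMap_range] at hx hy
  obtain ⟨x, rfl⟩ := hx
  obtain ⟨y, rfl⟩ := hy
  have := freeProj_rel R (.hh x y)
  rwa [LieHom.map_lie] at this

theorem lie_cartan_e (x : 𝔥) (i : ι) : ⁅cartanMap R x, eGen R i⁆ = R.root i x • eGen R i := by
  have := freeProj_rel R (.he x i)
  rwa [map_sub, sub_eq_zero, LieHom.map_lie, map_smul] at this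

theorem lie_cartan_f (x : 𝔥) (i : ι) : ⁅cartanMap R x, fGen R i⁆ = -(R.root i x • fGen R i) := by
  have := freeProj_rel R (.hf x i)
  rwa [map_add, add_eq_zero_iff_eq_neg, LieHom.map_lie, map_smul] at this

/-- The negative part, the subalgebra generated by the `f_i`. -/
def nNeg : LieSubalgebra ℂ R.Alg := LieSubalgebra.lieSpan ℂ R.Alg (Set.range (fGen R))

theorem e_mem (i : ι) : eGen R i ∈ R.nPos := LieSubalgebra.subset_lieSpan ⟨i, rfl⟩

theorem f_mem (i : ι) : fGen R i ∈ nNeg R := LieSubalgebra.subset_lieSpan ⟨i, rfl⟩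

/-- The span of the simple coroots. -/
def corootSpan : Submodule ℂ R.Alg := Submodule.span ℂ (Set.range fun i => cartanMap R (R.coroot i))

theorem coroot_mem (i : ι) : cartanMap R (R.coroot i) ∈ corootSpan R :=
  Submodule.subset_span ⟨i, rfl⟩

theorem corootSpan_le : corootSpan R ≤ R.cartan := by
  refine Submodule.span_le.2 ?_
  rintro _ ⟨i, rfl⟩
  exact cartanMap_mem R _

variable {R}

theorem lie_cartan_nPos {x y : R.Alg} (hx : x ∈ R.cartan) (hy : y ∈ R.nPos) : ⁅x, y⁆ ∈ R.nPos := by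
  rw [← cartanMap_range] at hx
  obtain ⟨x, rfl⟩ := hx
  induction hy using LieSubalgebra.lieSpan_induction with
  | mem y hy =>
    obtain ⟨i, rfl⟩ := hy
    rw [lie_cartan_e]
    exact R.nPos.smul_mem _ (e_mem R i)
  | zero => rw [lie_zero]; exact zero_mem _
  | add y z _ _ hy hz => rw [lie_add]; exact add_mem hy hz
  | smul a y _ hy => rw [lie_smul]; exact R.nPos.smul_mem _ hy
  | lie y z hy' hz' hy hz =>
    rw [leibniz_lie]
    exact add_mem (R.nPos.lie_mem hy hz') (R.nPos.lie_mem hy' hz)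

theorem lie_cartan_nNeg {x y : R.Alg} (hx : x ∈ R.cartan) (hy : y ∈ nNeg R) : ⁅x, y⁆ ∈ nNeg R := by
  rw [← cartanMap_range] at hx
  obtain ⟨x, rfl⟩ := hx
  induction hy using LieSubalgebra.lieSpan_induction with
  | mem y hy =>
    obtain ⟨i, rfl⟩ := hy
    rw [lie_cartan_f]
    exact neg_mem ((nNeg R).smul_mem _ (f_mem R i))
  | zero => rw [lie_zero]; exact zero_mem _
  | add y z _ _ hy hz => rw [lie_add]; exact add_mem hy hz
  | smul a y _ hy => rw [lie_smul]; exact (nNeg R).smul_mem _ hy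
  | lie y z hy' hz' hy hz =>
    rw [leibniz_lie]
    exact add_mem ((nNeg R).lie_mem hy hz') ((nNeg R).lie_mem hy' hz)

theorem lie_e_f_mem (i j : ι) : ⁅eGen R i, fGen R j⁆ ∈ corootSpan R := by
  by_cases h : i = j
  · subst h
    rw [lie_e_f_same]
    exact coroot_mem R i
  · rw [lie_e_f_ne R h]
    exact zero_mem _

/-- True for x = e_j by the defining relations. It passes to brackets because the coroots normalize
N⁺. -/
theorem lie_nPos_f {x : R.Alg} (hx : x ∈ R.nPos) (i : ι) :
    ⁅x, fGen R i⁆ ∈ R.nPos.toSubmodule ⊔ corootSpan R := by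
  induction hx using LieSubalgebra.lieSpan_induction with
  | mem y hy =>
    obtain ⟨j, rfl⟩ := hy
    exact Submodule.mem_sup_right (lie_e_f_mem j i)
  | zero => rw [zero_lie]; exact zero_mem _
  | add y z _ _ hy hz => rw [add_lie]; exact add_mem hy hz
  | smul a y _ hy => rw [smul_lie]; exact Submodule.smul_mem _ _ hy
  | lie y z hy' hz' hy hz =>
    have key : ∀ y ∈ R.nPos, ∀ z ∈ R.nPos.toSubmodule ⊔ corootSpan R, ⁅y, z⁆ ∈ R.nPos := by
      intro y hy z hz
      obtain ⟨z₁, h₁, z₂, h₂, rfl⟩ := Submodule.mem_sup.1 hz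
      rw [lie_add, ← lie_skew y z₂]
      exact add_mem (R.nPos.lie_mem hy h₁) (neg_mem (lie_cartan_nPos (corootSpan_le R h₂) hy))
    rw [lie_lie]
    exact Submodule.mem_sup_left (sub_mem (key y hy' _ hz) (key z hz' _ hy))

theorem lie_nNeg_e {x : R.Alg} (hx : x ∈ nNeg R) (i : ι) :
    ⁅x, eGen R i⁆ ∈ (nNeg R).toSubmodule ⊔ corootSpan R := by
  induction hx using LieSubalgebra.lieSpan_induction with
  | mem y hy =>
    obtain ⟨j, rfl⟩ := hy
    rw [← lie_skew]
    exact Submodule.mem_sup_right (neg_mem (lie_e_f_mem i j))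
  | zero => rw [zero_lie]; exact zero_mem _
  | add y z _ _ hy hz => rw [add_lie]; exact add_mem hy hz
  | smul a y _ hy => rw [smul_lie]; exact Submodule.smul_mem _ _ hy
  | lie y z hy' hz' hy hz =>
    have key : ∀ y ∈ nNeg R, ∀ z ∈ (nNeg R).toSubmodule ⊔ corootSpan R, ⁅y, z⁆ ∈ nNeg R := by
      intro y hy z hz
      obtain ⟨z₁, h₁, z₂, h₂, rfl⟩ := Submodule.mem_sup.1 hz
      rw [lie_add, ← lie_skew y z₂]
      exact add_mem ((nNeg R).lie_mem hy h₁) (neg_mem (lie_cartan_nNeg (corootSpan_le R h₂) hy))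
    rw [lie_lie]
    exact Submodule.mem_sup_left (sub_mem (key y hy' _ hz) (key z hz' _ hy))

/-- `N⁻ + s + N⁺` is a subalgebra for every subspace `s` of the Cartan subalgebra which contains
the coroots. -/
def triangular (s : Submodule ℂ R.Alg) (hs : corootSpan R ≤ s) (hs' : s ≤ R.cartan) :
    LieSubalgebra ℂ R.Alg where
  toSubmodule := (nNeg R).toSubmodule ⊔ s ⊔ R.nPos.toSubmodule
  lie_mem' := by
    set T := (nNeg R).toSubmodule ⊔ s ⊔ R.nPos.toSubmodule
    have hn : (nNeg R).toSubmodule ≤ T := le_sup_left.trans le_sup_left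
    have hsT : s ≤ T := le_sup_right.trans le_sup_left
    have hp : R.nPos.toSubmodule ≤ T := le_sup_right
    -- The elements x with [x, T] ⊆ T form a subalgebra, so N⁻ and N⁺ need only be tested on f_i and
    -- e_i.
    let Q : LieSubalgebra ℂ R.Alg :=
      { carrier := {x | ∀ y ∈ T, ⁅x, y⁆ ∈ T}
        add_mem' := fun hx hy w hw => by rw [add_lie]; exact add_mem (hx w hw) (hy w hw)
        zero_mem' := fun w _ => by rw [zero_lie]; exact zero_mem _
        smul_mem' := fun c x hx w hw => by rw [smul_lie]; exact Submodule.smul_mem _ _ (hx w hw)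
        lie_mem' := fun hx hy w hw => by
          rw [lie_lie]; exact sub_mem (hx _ (hy w hw)) (hy _ (hx w hw)) }
    have hQ : ∀ x : R.Alg, (∀ y ∈ nNeg R, ⁅x, y⁆ ∈ T) → (∀ y ∈ s, ⁅x, y⁆ ∈ T) →
        (∀ y ∈ R.nPos, ⁅x, y⁆ ∈ T) → x ∈ Q := by
      intro x h₁ h₂ h₃ y hy
      obtain ⟨u, hu, z, hz, rfl⟩ := Submodule.mem_sup.1 hy
      obtain ⟨v, hv, w, hw, rfl⟩ := Submodule.mem_sup.1 hu
      rw [lie_add, lie_add]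
      exact add_mem (add_mem (h₁ v hv) (h₂ w hw)) (h₃ z hz)
    have hQn : nNeg R ≤ Q := by
      refine LieSubalgebra.lieSpan_le.2 ?_
      rintro _ ⟨i, rfl⟩
      refine hQ _ (fun y hy => hn ((nNeg R).lie_mem (f_mem R i) hy)) (fun y hy => ?_)
        (fun y hy => ?_)
      · rw [← lie_skew]
        exact hn (neg_mem (lie_cartan_nNeg (hs' hy) (f_mem R i)))
      · rw [← lie_skew]
        exact neg_mem ((sup_le hp (hs.trans hsT)) (lie_nPos_f hy i))
    have hQp : R.nPos ≤ Q := by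
      refine LieSubalgebra.lieSpan_le.2 ?_
      rintro _ ⟨i, rfl⟩
      refine hQ _ (fun y hy => ?_) (fun y hy => ?_)
        (fun y hy => hp (R.nPos.lie_mem (e_mem R i) hy))
      · rw [← lie_skew]
        exact neg_mem ((sup_le hn (hs.trans hsT)) (lie_nNeg_e hy i))
      · rw [← lie_skew]
        exact hp (neg_mem (lie_cartan_nPos (hs' hy) (e_mem R i)))
    have hQs : s ≤ Q.toSubmodule := fun x hx =>
      hQ x (fun y hy => hn (lie_cartan_nNeg (hs' hx) hy))
        (fun y hy => by rw [lie_cartan_cartan R (hs' hx) (hs' hy)]; exact zero_mem _)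
        (fun y hy => hp (lie_cartan_nPos (hs' hx) hy))
    intro x y hx hy
    have hTQ : T ≤ Q.toSubmodule := sup_le (sup_le hQn hQs) hQp
    exact hTQ hx y hy

theorem triangular_eq_top :
    (nNeg R).toSubmodule ⊔ R.cartan ⊔ R.nPos.toSubmodule = ⊤ := by
  have h := subalgebra_eq_top R (triangular R.cartan (corootSpan_le R) le_rfl) ?_
  · exact congrArg LieSubalgebra.toSubmodule h
  · rintro (i | i | x)
    · exact Submodule.mem_sup_right (e_mem R i)
    · exact Submodule.mem_sup_left (Submodule.mem_sup_left (f_mem R i))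
    · exact Submodule.mem_sup_left (Submodule.mem_sup_right (cartanMap_mem R x))

/-- The subalgebra Q = N⁻ + (coroots) + N⁺ is stable under the commutative algebra h, and 𝒢 = h + Q,
so every bracket falls into Q. -/
theorem derived_le : LieSubmodule.toSubmodule R.derived ≤
    (nNeg R).toSubmodule ⊔ corootSpan R ⊔ R.nPos.toSubmodule := by
  set Q := triangular (corootSpan R) le_rfl (corootSpan_le R)
  change _ ≤ Q.toSubmodule
  have hn : (nNeg R).toSubmodule ≤ Q.toSubmodule := le_sup_left.trans le_sup_left
  have hs : corootSpan R ≤ Q.toSubmodule := le_sup_right.trans le_sup_left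
  have hp : R.nPos.toSubmodule ≤ Q.toSubmodule := le_sup_right
  have hc : ∀ x ∈ R.cartan, ∀ y ∈ Q, ⁅x, y⁆ ∈ Q := by
    intro x hx y hy
    obtain ⟨u, hu, z, hz, rfl⟩ := Submodule.mem_sup.1 hy
    obtain ⟨v, hv, w, hw, rfl⟩ := Submodule.mem_sup.1 hu
    rw [lie_add, lie_add, lie_cartan_cartan R hx (corootSpan_le R hw), add_zero]
    exact add_mem (hn (lie_cartan_nNeg hx hv)) (hp (lie_cartan_nPos hx hz))
  have hsplit : ∀ x : R.Alg, ∃ y ∈ R.cartan, ∃ z ∈ Q, x = y + z := by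
    intro x
    obtain ⟨u, hu, z, hz, rfl⟩ := Submodule.mem_sup.1
      (triangular_eq_top (R := R) ▸ Submodule.mem_top :
        x ∈ (nNeg R).toSubmodule ⊔ R.cartan ⊔ R.nPos.toSubmodule)
    obtain ⟨v, hv, w, hw, rfl⟩ := Submodule.mem_sup.1 hu
    exact ⟨w, hw, v + z, add_mem (hn hv) (hp hz), by abel⟩
  rw [Realization.derived, LieSubmodule.lieIdeal_oper_eq_linear_span', Submodule.span_le]
  rintro _ ⟨x, -, y, -, rfl⟩
  obtain ⟨x₁, hx₁, x₂, hx₂, rfl⟩ := hsplit x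
  obtain ⟨y₁, hy₁, y₂, hy₂, rfl⟩ := hsplit y
  rw [add_lie, lie_add, lie_add, lie_cartan_cartan R hx₁ hy₁, zero_add, ← lie_skew x₂ y₁]
  exact add_mem (hc _ hx₁ _ hy₂) (add_mem (neg_mem (hc _ hy₁ _ hx₂)) (Q.lie_mem hx₂ hy₂))

theorem lie_mem_derived (x y : R.Alg) : ⁅x, y⁆ ∈ R.derived :=
  LieSubmodule.lie_mem_lie (LieSubmodule.mem_top x) (LieSubmodule.mem_top y)

theorem root_coroot_self (hC : IsGCM C) (i : ι) : R.root i (R.coroot i) = 2 := by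
  rw [R.root_coroot, hC.diag]
  norm_num

/-- Since the diagonal entries are 2, e_i = ½[α_i^∨, e_i]. -/
theorem nPos_le_derived (hC : IsGCM C) : R.nPos.toSubmodule ≤ R.derived.toSubmodule := by
  have : R.nPos ≤ (R.derived : LieSubalgebra ℂ R.Alg) := by
    refine LieSubalgebra.lieSpan_le.2 ?_
    rintro _ ⟨i, rfl⟩
    have h := lie_mem_derived (cartanMap R (R.coroot i)) (eGen R i)
    rw [lie_cartan_e, root_coroot_self hC] at h
    have h2 := R.derived.smul_mem (2⁻¹ : ℂ) h
    rwa [smul_smul, inv_mul_cancel₀ two_ne_zero, one_smul] at h2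
  exact this

theorem nNeg_le_derived (hC : IsGCM C) : (nNeg R).toSubmodule ≤ R.derived.toSubmodule := by
  have : nNeg R ≤ (R.derived : LieSubalgebra ℂ R.Alg) := by
    refine LieSubalgebra.lieSpan_le.2 ?_
    rintro _ ⟨i, rfl⟩
    have h := lie_mem_derived (cartanMap R (R.coroot i)) (fGen R i)
    rw [lie_cartan_f, root_coroot_self hC] at h
    have h2 := R.derived.smul_mem (-2⁻¹ : ℂ) h
    rwa [smul_neg, neg_smul, neg_neg, smul_smul, inv_mul_cancel₀ two_ne_zero, one_smul] at h2
  exact this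

theorem corootSpan_le_cartan' : corootSpan R ≤ R.cartan' := by
  refine le_inf (corootSpan_le R) (Submodule.span_le.2 ?_)
  rintro _ ⟨i, rfl⟩
  change cartanMap R (R.coroot i) ∈ R.derived
  rw [← lie_e_f_same]
  exact lie_mem_derived _ _

/-- Independence of the roots yields a functional on 𝔥* equal to 1 on each of them; finite
dimensionality makes it evaluation at a point. -/
theorem exists_grading [FiniteDimensional ℂ 𝔥] (R : Realization C 𝔥) :
    ∃ ρ : 𝔥, ∀ i, R.root i ρ = 1 := by
  obtain ⟨g, hg⟩ := (Finsupp.linearCombination ℂ R.root).exists_leftInverse_of_injective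
    (LinearMap.ker_eq_bot.2 R.root_indep)
  let φ : Module.Dual ℂ (Module.Dual ℂ 𝔥) := Finsupp.linearCombination ℂ (fun _ : ι => (1 : ℂ)) ∘ₗ g
  refine ⟨(Module.evalEquiv ℂ 𝔥).symm φ, fun i => ?_⟩
  have h1 : g (R.root i) = Finsupp.single i 1 := by
    have := LinearMap.congr_fun hg (Finsupp.single i 1)
    rwa [LinearMap.comp_apply, Finsupp.linearCombination_single, one_smul] at this
  rw [Module.apply_evalEquiv_symm_apply, LinearMap.comp_apply, h1,
    Finsupp.linearCombination_single, one_smul]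

/-- The eigenvalues on the positive part. -/
def above : Set ℂ := {z | ∃ m : ℕ, z = m + 1}

theorem nPos_le_degPart {ρ : 𝔥} (hρ : ∀ i, R.root i ρ = 1) : R.nPos.toSubmodule ≤
    degPart (LieModule.toEnd ℂ R.Alg R.Alg (cartanMap R ρ)) above := by
  intro x hx
  induction hx using LieSubalgebra.lieSpan_induction with
  | mem y hy =>
    obtain ⟨i, rfl⟩ := hy
    refine mem_degPart (μ := 1) (show (1 : ℂ) ∈ above from ⟨0, by simp⟩) (by
      rw [LieModule.toEnd_apply_apply, lie_cartan_e, hρ])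
  | zero => exact zero_mem _
  | add y z _ _ hy hz => exact add_mem hy hz
  | smul a y _ hy => exact Submodule.smul_mem _ _ hy
  | lie y z _ _ hy hz =>
    refine lie_mem_degPart ?_ hy hz
    rintro _ ⟨i, rfl⟩ _ ⟨j, rfl⟩
    exact ⟨i + j + 1, by push_cast; ring⟩

theorem nNeg_le_degPart {ρ : 𝔥} (hρ : ∀ i, R.root i ρ = 1) : (nNeg R).toSubmodule ≤
    degPart (LieModule.toEnd ℂ R.Alg R.Alg (cartanMap R ρ)) (below 0) := by
  intro x hx
  induction hx using LieSubalgebra.lieSpan_induction with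
  | mem y hy =>
    obtain ⟨i, rfl⟩ := hy
    refine mem_degPart (μ := -1) (show (-1 : ℂ) ∈ below 0 from ⟨0, by simp⟩) (by
      rw [LieModule.toEnd_apply_apply, lie_cartan_f, hρ, neg_smul])
  | zero => exact zero_mem _
  | add y z _ _ hy hz => exact add_mem hy hz
  | smul a y _ hy => exact Submodule.smul_mem _ _ hy
  | lie y z _ _ hy hz =>
    refine lie_mem_degPart ?_ hy hz
    rintro _ ⟨i, rfl⟩ _ ⟨j, rfl⟩
    exact ⟨i + j + 1, by push_cast; ring⟩

theorem cartan_le_degPart (ρ : 𝔥) : R.cartan ≤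
    degPart (LieModule.toEnd ℂ R.Alg R.Alg (cartanMap R ρ)) {0} := by
  intro x hx
  rw [degPart_singleton, LieModule.toEnd_apply_apply, zero_smul]
  exact lie_cartan_cartan R (cartanMap_mem R ρ) hx

theorem above_disjoint_below : Disjoint above (below (0 : ℂ)) := by
  rw [Set.disjoint_left]
  rintro _ ⟨i, rfl⟩ ⟨j, hj⟩
  have : ((i + 1 + j : ℕ) : ℂ) + 1 = 0 := by push_cast; linear_combination hj
  exact Nat.cast_add_one_ne_zero _ this

theorem zero_disjoint_above : Disjoint {0} above := by
  rw [Set.disjoint_singleton_left]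
  rintro ⟨i, hi⟩
  exact Nat.cast_add_one_ne_zero i hi.symm

theorem zero_disjoint_below : Disjoint {0} (below (0 : ℂ)) :=
  Set.disjoint_singleton_left.2 (not_mem_below 0)

/-- `h'` is spanned by the coroots. -/
theorem cartan'_eq [FiniteDimensional ℂ 𝔥] : R.cartan' = corootSpan R := by
  refine le_antisymm (fun x hx => ?_) corootSpan_le_cartan'
  obtain ⟨ρ, hρ⟩ := exists_grading R
  obtain ⟨u, hu, p, hp, rfl⟩ := Submodule.mem_sup.1 (derived_le hx.2)
  obtain ⟨m, hm, s, hs, rfl⟩ := Submodule.mem_sup.1 hu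
  set D := LieModule.toEnd ℂ R.Alg R.Alg (cartanMap R ρ)
  -- Both x and its coroot part have degree 0, whereas the N⁻ and N⁺ parts have only nonzero
  -- degrees, so the latter add up to zero.
  have h0 : m + p ∈ degPart D {0} := by
    have := sub_mem (cartan_le_degPart ρ hx.1) (cartan_le_degPart ρ (corootSpan_le R hs))
    convert this using 1
    abel
  have h1 : m + p ∈ degPart D (above ∪ below 0) :=
    add_mem (degPart_mono Set.subset_union_right (nNeg_le_degPart hρ hm))
      (degPart_mono Set.subset_union_left (nPos_le_degPart hρ hp))
  have h2 : m + p = 0 := Submodule.disjoint_def.1 (degPart_disjoint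
    (Set.disjoint_union_right.2 ⟨zero_disjoint_above, zero_disjoint_below⟩)) _ h0 h1
  rw [add_right_comm, h2, zero_add]
  exact hs

/-- The simple roots as functionals on the Cartan subalgebra of `𝒢`. -/
theorem exists_root_on_cartan (i : ι) : ∃ α : Module.Dual ℂ R.cartan,
    ∀ x : R.cartan, ⁅(x : R.Alg), fGen R i⁆ = -(α x • fGen R i) := by
  let c : 𝔥 →ₗ[ℂ] R.cartan := (cartanMap R).codRestrict R.cartan (cartanMap_mem R)
  have hc : LinearMap.range c = ⊤ := by
    rw [LinearMap.range_eq_top]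
    rintro ⟨x, hx⟩
    obtain ⟨y, rfl⟩ := (cartanMap_range R ▸ hx : x ∈ LinearMap.range (cartanMap R))
    exact ⟨y, rfl⟩
  -- Any linear section of 𝔥 → h will do, so injectivity of that map is not needed.
  obtain ⟨s, hs⟩ := c.exists_rightInverse_of_surjective hc
  refine ⟨R.root i ∘ₗ s, fun x => ?_⟩
  have hx : cartanMap R (s x) = x := congrArg Subtype.val (LinearMap.congr_fun hs x)
  rw [← hx, lie_cartan_f, LinearMap.comp_apply]

end Structure

/-! ### Borel subalgebra, generators and grading of 𝒢'_A ⊕ h''. -/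

section LoopStructure

variable {ι : Type*} [Fintype ι] {C : Matrix ι ι ℤ}
  {𝔥 : Type*} [AddCommGroup 𝔥] [Module ℂ 𝔥] {R : Realization C 𝔥} {n : ℕ}

theorem lie_mem_tensorSub_of {J J' J'' : Submodule ℂ (Laurent n)} {S S' S'' : Submodule ℂ R.Alg}
    (hJ : ∀ a ∈ J, ∀ b ∈ J', a * b ∈ J'') (hS : ∀ x ∈ S, ∀ y ∈ S', ⁅x, y⁆ ∈ S'')
    {u w : Laurent n ⊗[ℂ] R.Alg} (hu : u ∈ tensorSub J S) (hw : w ∈ tensorSub J' S') :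
    ⁅u, w⁆ ∈ tensorSub J'' S'' := by
  have h1 : tensorSub J S ≤ (tensorSub J'' S'').comap
      ((LieModule.toEnd ℂ (Laurent n ⊗[ℂ] R.Alg) (Laurent n ⊗[ℂ] R.Alg) :
        _ →ₗ[ℂ] Module.End ℂ (Laurent n ⊗[ℂ] R.Alg)).flip w) := by
    refine Submodule.map₂_le.2 fun a ha x hx => ?_
    have h2 : tensorSub J' S' ≤ (tensorSub J'' S'').comap
        (LieModule.toEnd ℂ (Laurent n ⊗[ℂ] R.Alg) (Laurent n ⊗[ℂ] R.Alg) (a ⊗ₜ[ℂ] x)) := by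
      refine Submodule.map₂_le.2 fun b hb y hy => ?_
      exact Submodule.apply_mem_map₂ (TensorProduct.mk ℂ (Laurent n) R.Alg) (hJ a ha b hb)
        (hS x hx y hy)
    exact h2 hw
  exact h1 hu

theorem tmul_mem_tensorSub {J : Submodule ℂ (Laurent n)} {S : Submodule ℂ R.Alg} {a : Laurent n}
    (ha : a ∈ J) {x : R.Alg} (hx : x ∈ S) : a ⊗ₜ[ℂ] x ∈ tensorSub J S :=
  Submodule.apply_mem_map₂ (TensorProduct.mk ℂ (Laurent n) R.Alg) ha hx

theorem oneSub_le (S : Submodule ℂ R.Alg) : oneSub n S ≤ tensorSub ⊤ S := by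
  rintro _ ⟨x, hx, rfl⟩
  exact tmul_mem_tensorSub Submodule.mem_top hx

theorem tensorSub_mono {J J' : Submodule ℂ (Laurent n)} {S S' : Submodule ℂ R.Alg} (hJ : J ≤ J')
    (hS : S ≤ S') : tensorSub J S ≤ tensorSub J' S' :=
  Submodule.map₂_le_map₂ hJ hS

variable {K : R.Complement}

theorem carrier_le_cartan : K.carrier ≤ R.cartan := K.sup_eq ▸ le_sup_right

/-- The element `a ⊗ x` of `𝒢'_A ⊕ h''`, for `x ∈ 𝒢'`. -/
def loopTmul (K : R.Complement) (a : Laurent n) (x : R.Alg) (hx : x ∈ R.derived) : loopAlg n K :=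
  ⟨a ⊗ₜ[ℂ] x, Submodule.mem_sup_left (tmul_mem_tensorSub Submodule.mem_top hx)⟩

theorem loopTmul_lie {a b : Laurent n} {x y : R.Alg} (hx : x ∈ R.derived) (hy : y ∈ R.derived) :
    ⁅loopTmul K a x hx, loopTmul K b y hy⁆ = loopTmul K (a * b) ⁅x, y⁆ (lie_mem_derived x y) := rfl

theorem cartanOne_lie_loopTmul {a : Laurent n} {h : R.cartan} {x : R.Alg} (hx : x ∈ R.derived) :
    ⁅cartanOne n K h, loopTmul K a x hx⁆ = loopTmul K a ⁅(h : R.Alg), x⁆ (lie_mem_derived _ x) := by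
  apply Subtype.ext
  change ((1 : Laurent n) * a) ⊗ₜ[ℂ] ⁅(h : R.Alg), x⁆ = a ⊗ₜ[ℂ] ⁅(h : R.Alg), x⁆
  rw [one_mul]

/-- Pushing T forward into A ⊗ 𝒢 allows a check on pure tensors that already lie in the loop
algebra. -/
theorem mem_of_mem_tensorSub {J : Submodule ℂ (Laurent n)} {S : Submodule ℂ R.Alg}
    (hS : S ≤ R.derived.toSubmodule) {T : Submodule ℂ (loopAlg n K)}
    (h : ∀ a ∈ J, ∀ x, ∀ hx : x ∈ S, loopTmul K a x (hS hx) ∈ T) {y : loopAlg n K}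
    (hy : (y : Laurent n ⊗[ℂ] R.Alg) ∈ tensorSub J S) : y ∈ T := by
  have hle : tensorSub J S ≤ T.map (loopAlg n K).toSubmodule.subtype :=
    Submodule.map₂_le.2 fun a ha x hx => ⟨_, h a ha x hx, rfl⟩
  obtain ⟨z, hz, hzy⟩ := hle hy
  have : z = y := Subtype.ext hzy
  exact this ▸ hz

theorem mem_of_mem_sup {J : Submodule ℂ (Laurent n)} {S : Submodule ℂ R.Alg}
    (hS : S ≤ R.derived.toSubmodule) {T : Submodule ℂ (loopAlg n K)}
    (h : ∀ a ∈ J, ∀ x, ∀ hx : x ∈ S, loopTmul K a x (hS hx) ∈ T)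
    (h' : ∀ x, ∀ hx : x ∈ K.carrier, cartanOne n K ⟨x, carrier_le_cartan hx⟩ ∈ T) {y : loopAlg n K}
    (hy : (y : Laurent n ⊗[ℂ] R.Alg) ∈ tensorSub J S ⊔ oneSub n K.carrier) : y ∈ T := by
  have hle : tensorSub J S ⊔ oneSub n K.carrier ≤ T.map (loopAlg n K).toSubmodule.subtype := by
    refine sup_le (Submodule.map₂_le.2 fun a ha x hx => ⟨_, h a ha x hx, rfl⟩) ?_
    rintro _ ⟨x, hx, rfl⟩
    exact ⟨_, h' x hx, rfl⟩
  obtain ⟨z, hz, hzy⟩ := hle hy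
  have : z = y := Subtype.ext hzy
  exact this ▸ hz

theorem cartan'_le_derived : R.cartan' ≤ R.derived.toSubmodule := inf_le_right

theorem corootSpan_le_derived : corootSpan R ≤ R.derived.toSubmodule :=
  corootSpan_le_cartan'.trans cartan'_le_derived

theorem loopTmul_mem_loopPos {a : Laurent n} {x : R.Alg} (hx : x ∈ R.derived) (hx' : x ∈ R.nPos) :
    loopTmul K a x hx ∈ loopPos n K :=
  tmul_mem_tensorSub (S := R.nPos.toSubmodule) Submodule.mem_top hx'

theorem loopTmul_mem_loopCartan {a : Laurent n} {x : R.Alg} (hx : x ∈ R.derived)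
    (hx' : x ∈ R.cartan') : loopTmul K a x hx ∈ loopCartan n K :=
  Submodule.mem_sup_left (tmul_mem_tensorSub (S := R.cartan') Submodule.mem_top hx')

theorem cartanOne_mem_loopCartan (x : R.cartan) : cartanOne n K x ∈ loopCartan n K := by
  have hx : (x : R.Alg) ∈ R.cartan' ⊔ K.carrier := by rw [K.sup_eq]; exact x.2
  obtain ⟨y, hy, z, hz, hyz⟩ := Submodule.mem_sup.1 hx
  change (1 : Laurent n) ⊗ₜ[ℂ] (x : R.Alg) ∈ tensorSub ⊤ R.cartan' ⊔ oneSub n K.carrier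
  rw [← hyz, TensorProduct.tmul_add]
  exact add_mem (Submodule.mem_sup_left (tmul_mem_tensorSub Submodule.mem_top hy))
    (Submodule.mem_sup_right (Submodule.mem_map_of_mem hz))

theorem loopCartan_coe_mem {y : loopAlg n K} (hy : y ∈ loopCartan n K) :
    (y : Laurent n ⊗[ℂ] R.Alg) ∈ tensorSub ⊤ R.cartan := by
  have hle : tensorSub (n := n) ⊤ R.cartan' ⊔ oneSub n K.carrier ≤ tensorSub ⊤ R.cartan :=
    sup_le (tensorSub_mono le_rfl inf_le_left)
      ((oneSub_le _).trans (tensorSub_mono le_rfl carrier_le_cartan))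
  exact hle hy

theorem tensorSub_bot (J : Submodule ℂ (Laurent n)) : tensorSub J (⊥ : Submodule ℂ R.Alg) = ⊥ :=
  Submodule.map₂_bot_right _ _

theorem lie_loopCartan_loopCartan {y z : loopAlg n K} (hy : y ∈ loopCartan n K)
    (hz : z ∈ loopCartan n K) : ⁅y, z⁆ = 0 := by
  apply Subtype.ext
  have h := lie_mem_tensorSub_of (J'' := ⊤) (S'' := ⊥) (fun _ _ _ _ => Submodule.mem_top)
    (fun x hx y hy => (Submodule.mem_bot ℂ).2 (lie_cartan_cartan R hx hy))
    (loopCartan_coe_mem hy) (loopCartan_coe_mem hz)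
  rw [tensorSub_bot] at h
  exact (Submodule.mem_bot ℂ).1 h

theorem lie_loopCartan_loopPos {y z : loopAlg n K} (hy : y ∈ loopCartan n K)
    (hz : z ∈ loopPos n K) : ⁅y, z⁆ ∈ loopPos n K :=
  lie_mem_tensorSub_of (S := R.cartan) (fun _ _ _ _ => Submodule.mem_top)
    (fun _ hx _ hy => lie_cartan_nPos hx hy) (loopCartan_coe_mem hy) hz

theorem lie_loopPos_loopPos {y z : loopAlg n K} (hy : y ∈ loopPos n K)
    (hz : z ∈ loopPos n K) : ⁅y, z⁆ ∈ loopPos n K :=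
  lie_mem_tensorSub_of (fun _ _ _ _ => Submodule.mem_top)
    (fun _ hx _ hy => R.nPos.lie_mem hx hy) hy hz

/-- The Borel subalgebra `B' = H ⊕ N⁺_A`. -/
def loopBorel (n : ℕ) (K : R.Complement) : Submodule ℂ (loopAlg n K) :=
  loopCartan n K ⊔ loopPos n K

theorem lie_loopBorel_loopBorel {y z : loopAlg n K} (hy : y ∈ loopBorel n K)
    (hz : z ∈ loopBorel n K) : ⁅y, z⁆ ∈ loopPos n K := by
  obtain ⟨y₁, hy₁, y₂, hy₂, rfl⟩ := Submodule.mem_sup.1 hy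
  obtain ⟨z₁, hz₁, z₂, hz₂, rfl⟩ := Submodule.mem_sup.1 hz
  rw [add_lie, lie_add, lie_add, lie_loopCartan_loopCartan hy₁ hz₁, zero_add, ← lie_skew y₂ z₁]
  exact add_mem (lie_loopCartan_loopPos hy₁ hz₂) (add_mem
    (neg_mem (lie_loopCartan_loopPos hz₁ hy₂)) (lie_loopPos_loopPos hy₂ hz₂))

/-- The span of all `a ⊗ f_i`. -/
def loopF (n : ℕ) (K : R.Complement) : Submodule ℂ (loopAlg n K) :=
  (tensorSub ⊤ (Submodule.span ℂ (Set.range (fGen R)))).comap (loopAlg n K).toSubmodule.subtype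

theorem fSpan_le_nNeg : Submodule.span ℂ (Set.range (fGen R)) ≤ (nNeg R).toSubmodule :=
  LieSubalgebra.submodule_span_le_lieSpan

/-- H preserves the span of the a ⊗ f_i, as the f_i are weight vectors; N⁺_A sends it into N⁺_A plus
loops in the coroots. This is the commutation needed to build submodules from words. -/
theorem lie_loopBorel_loopF (hC : IsGCM C) {b y : loopAlg n K} (hb : b ∈ loopBorel n K)
    (hy : y ∈ loopF n K) : ⁅b, y⁆ ∈ loopF n K ⊔ loopBorel n K := by
  obtain ⟨h, hh, p, hp, rfl⟩ := Submodule.mem_sup.1 hb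
  rw [add_lie]
  refine add_mem (Submodule.mem_sup_left ?_) ?_
  · refine lie_mem_tensorSub_of (S := R.cartan) (fun _ _ _ _ => Submodule.mem_top) ?_
      (loopCartan_coe_mem hh) hy
    intro x hx z hz
    rw [← cartanMap_range] at hx
    obtain ⟨x, rfl⟩ := hx
    have hle : Submodule.span ℂ (Set.range (fGen R)) ≤ (Submodule.span ℂ (Set.range (fGen R))).comap
        (LieModule.toEnd ℂ R.Alg R.Alg (cartanMap R x)) := by
      refine Submodule.span_le.2 ?_
      rintro _ ⟨i, rfl⟩
      change ⁅cartanMap R x, fGen R i⁆ ∈ Submodule.span ℂ (Set.range (fGen R))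
      rw [lie_cartan_f]
      exact neg_mem (Submodule.smul_mem _ _ (Submodule.subset_span ⟨i, rfl⟩))
    exact hle hz
  · have hS : R.nPos.toSubmodule ⊔ corootSpan R ≤ R.derived.toSubmodule :=
      sup_le (nPos_le_derived hC) corootSpan_le_derived
    refine mem_of_mem_tensorSub (J := ⊤) hS (T := loopF n K ⊔ loopBorel n K)
      (fun a _ x hx => ?_) ?_
    · refine Submodule.mem_sup_right ?_
      obtain ⟨u, hu, w, hw, rfl⟩ := Submodule.mem_sup.1 hx
      have he : loopTmul K a (u + w) (hS hx) = loopTmul K a u (nPos_le_derived hC hu) +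
          loopTmul K a w (corootSpan_le_derived hw) :=
        Subtype.ext (TensorProduct.tmul_add _ _ _)
      rw [he]
      exact add_mem (Submodule.mem_sup_right (loopTmul_mem_loopPos _ hu))
        (Submodule.mem_sup_left (loopTmul_mem_loopCartan _ (corootSpan_le_cartan' hw)))
    · refine lie_mem_tensorSub_of (fun _ _ _ _ => Submodule.mem_top) ?_ hp hy
      intro x hx z hz
      have hle : Submodule.span ℂ (Set.range (fGen R)) ≤
          (R.nPos.toSubmodule ⊔ corootSpan R).comap (LieModule.toEnd ℂ R.Alg R.Alg x) := by
        refine Submodule.span_le.2 ?_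
        rintro _ ⟨i, rfl⟩
        exact lie_nPos_f hx i
      exact hle hz

theorem loopTmul_mem_of_mem_lieSpan {g : ι → R.Alg} (hg : ∀ i, g i ∈ R.derived)
    (Q : LieSubalgebra ℂ (loopAlg n K)) (h : ∀ a i, loopTmul K a (g i) (hg i) ∈ Q) {x : R.Alg}
    (hx : x ∈ LieSubalgebra.lieSpan ℂ R.Alg (Set.range g)) :
    ∃ hx' : x ∈ R.derived, ∀ a, loopTmul K a x hx' ∈ Q := by
  induction hx using LieSubalgebra.lieSpan_induction with
  | mem y hy =>
    obtain ⟨i, rfl⟩ := hy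
    exact ⟨hg i, fun a => h a i⟩
  | zero =>
    refine ⟨zero_mem _, fun a => ?_⟩
    have he : loopTmul K a (0 : R.Alg) (zero_mem _) = 0 := Subtype.ext (TensorProduct.tmul_zero _ _)
    rw [he]
    exact zero_mem _
  | add y z _ _ hy hz =>
    obtain ⟨hy', hy⟩ := hy
    obtain ⟨hz', hz⟩ := hz
    refine ⟨add_mem hy' hz', fun a => ?_⟩
    have he : loopTmul K a (y + z) (add_mem hy' hz') = loopTmul K a y hy' + loopTmul K a z hz' :=
      Subtype.ext (TensorProduct.tmul_add _ _ _)
    rw [he]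
    exact add_mem (hy a) (hz a)
  | smul c y _ hy =>
    obtain ⟨hy', hy⟩ := hy
    refine ⟨R.derived.smul_mem c hy', fun a => ?_⟩
    have he : loopTmul K a (c • y) (R.derived.smul_mem c hy') = c • loopTmul K a y hy' :=
      Subtype.ext (TensorProduct.tmul_smul _ _ _)
    rw [he]
    exact Q.smul_mem c (hy a)
  | lie y z _ _ hy hz =>
    obtain ⟨hy', hy⟩ := hy
    obtain ⟨hz', hz⟩ := hz
    refine ⟨lie_mem_derived y z, fun a => ?_⟩
    -- The whole coefficient goes on one factor: a ⊗ [y, z] = [a ⊗ y, 1 ⊗ z].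
    have he := Q.lie_mem (hy a) (hz 1)
    rw [loopTmul_lie] at he
    simpa only [mul_one] using he

theorem e_mem_derived (hC : IsGCM C) (i : ι) : eGen R i ∈ R.derived :=
  nPos_le_derived hC (e_mem R i)

theorem f_mem_derived (hC : IsGCM C) (i : ι) : fGen R i ∈ R.derived :=
  nNeg_le_derived hC (f_mem R i)

theorem loopTmul_f_mem_loopF {a : Laurent n} {i : ι} (h : fGen R i ∈ R.derived) :
    loopTmul K a (fGen R i) h ∈ loopF n K :=
  tmul_mem_tensorSub Submodule.mem_top (Submodule.subset_span ⟨i, rfl⟩)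

/-- To show that a subspace is everything it suffices to look at the three parts of `𝒢'` and
at `h''`. -/
theorem mem_of_triangular (hC : IsGCM C) {T : Submodule ℂ (loopAlg n K)} (hB : loopBorel n K ≤ T)
    (hN : ∀ a, ∀ x, ∀ hx : x ∈ nNeg R, loopTmul K a x (nNeg_le_derived hC hx) ∈ T)
    (y : loopAlg n K) : y ∈ T := by
  have hH : loopCartan n K ≤ T := le_sup_left.trans hB
  have hP : loopPos n K ≤ T := le_sup_right.trans hB
  refine mem_of_mem_sup (J := ⊤) le_rfl (fun a _ x hx => ?_)
    (fun x hx => hH (cartanOne_mem_loopCartan _)) y.2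
  obtain ⟨u, hu, p, hp, rfl⟩ := Submodule.mem_sup.1 (derived_le hx)
  obtain ⟨m, hm, s, hs, rfl⟩ := Submodule.mem_sup.1 hu
  have he : loopTmul K a (m + s + p) hx = loopTmul K a m (nNeg_le_derived hC hm) +
      loopTmul K a s (corootSpan_le_derived hs) + loopTmul K a p (nPos_le_derived hC hp) := by
    apply Subtype.ext
    change a ⊗ₜ[ℂ] (m + s + p) = a ⊗ₜ[ℂ] m + a ⊗ₜ[ℂ] s + a ⊗ₜ[ℂ] p
    rw [TensorProduct.tmul_add, TensorProduct.tmul_add]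
  rw [he]
  exact add_mem (add_mem (hN a m hm)
    (hH (loopTmul_mem_loopCartan _ (corootSpan_le_cartan' hs)))) (hP (loopTmul_mem_loopPos _ hp))

theorem lieSpan_loopF_loopBorel (hC : IsGCM C) :
    LieSubalgebra.lieSpan ℂ (loopAlg n K) ((loopF n K : Set (loopAlg n K)) ∪ loopBorel n K) = ⊤ := by
  set Q := LieSubalgebra.lieSpan ℂ (loopAlg n K)
    ((loopF n K : Set (loopAlg n K)) ∪ loopBorel n K)
  refine eq_top_iff.2 fun y _ => ?_
  refine mem_of_triangular hC (T := Q.toSubmodule) ?_ ?_ y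
  · exact fun z hz => LieSubalgebra.subset_lieSpan (Or.inr hz)
  · intro a x hx
    exact (loopTmul_mem_of_mem_lieSpan (f_mem_derived hC) Q
      (fun a i => LieSubalgebra.subset_lieSpan (Or.inl (loopTmul_f_mem_loopF _))) hx).2 a

/-- The grading element of `𝒢'_A ⊕ h''`. -/
def loopGrading (n : ℕ) (K : R.Complement) (ρ : 𝔥) : loopAlg n K :=
  cartanOne n K ⟨cartanMap R ρ, cartanMap_mem R ρ⟩

/-- The sum of the eigenspaces with eigenvalues in an additively closed set, as a subalgebra. -/
def degSubalgebra {k L : Type*} [Field k] [LieRing L] [LieAlgebra k L] (d : L) (s : Set k)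
    (hs : ∀ a ∈ s, ∀ b ∈ s, a + b ∈ s) : LieSubalgebra k L where
  toSubmodule := degPart (LieModule.toEnd k L L d) s
  lie_mem' := lie_mem_degPart hs

theorem above_add (a : ℂ) (ha : a ∈ above) (b : ℂ) (hb : b ∈ above) : a + b ∈ above := by
  obtain ⟨i, rfl⟩ := ha
  obtain ⟨j, rfl⟩ := hb
  exact ⟨i + j + 1, by push_cast; ring⟩

theorem below_add (a : ℂ) (ha : a ∈ below (0 : ℂ)) (b : ℂ) (hb : b ∈ below (0 : ℂ)) :
    a + b ∈ below (0 : ℂ) := by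
  obtain ⟨i, rfl⟩ := ha
  obtain ⟨j, rfl⟩ := hb
  exact ⟨i + j + 1, by push_cast; ring⟩

variable {ρ : 𝔥}

theorem loopGrading_lie_f (hC : IsGCM C) (hρ : ∀ i, R.root i ρ = 1) (a : Laurent n) (i : ι) :
    ⁅loopGrading n K ρ, loopTmul K a (fGen R i) (f_mem_derived hC i)⁆ =
      -loopTmul K a (fGen R i) (f_mem_derived hC i) := by
  rw [loopGrading, cartanOne_lie_loopTmul]
  apply Subtype.ext
  change a ⊗ₜ[ℂ] ⁅cartanMap R ρ, fGen R i⁆ = -(a ⊗ₜ[ℂ] fGen R i)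
  rw [lie_cartan_f, hρ, one_smul, TensorProduct.tmul_neg]

theorem loopGrading_lie_e (hC : IsGCM C) (hρ : ∀ i, R.root i ρ = 1) (a : Laurent n) (i : ι) :
    ⁅loopGrading n K ρ, loopTmul K a (eGen R i) (e_mem_derived hC i)⁆ =
      loopTmul K a (eGen R i) (e_mem_derived hC i) := by
  rw [loopGrading, cartanOne_lie_loopTmul]
  apply Subtype.ext
  change a ⊗ₜ[ℂ] ⁅cartanMap R ρ, eGen R i⁆ = a ⊗ₜ[ℂ] eGen R i
  rw [lie_cartan_e, hρ, one_smul]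

theorem loopTmul_nNeg_mem_degPart (hC : IsGCM C) (hρ : ∀ i, R.root i ρ = 1) (a : Laurent n)
    {x : R.Alg} (hx : x ∈ nNeg R) (hx' : x ∈ R.derived) : loopTmul K a x hx' ∈
      degPart (LieModule.toEnd ℂ (loopAlg n K) (loopAlg n K) (loopGrading n K ρ)) (below 0) := by
  refine (loopTmul_mem_of_mem_lieSpan (f_mem_derived hC)
    (degSubalgebra (loopGrading n K ρ) (below 0) below_add) (fun a i => ?_) hx).2 a
  refine mem_degPart (μ := -1) (show (-1 : ℂ) ∈ below 0 from ⟨0, by simp⟩) ?_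
  rw [LieModule.toEnd_apply_apply, loopGrading_lie_f hC hρ, neg_smul, one_smul]

theorem loopPos_le_degPart (hC : IsGCM C) (hρ : ∀ i, R.root i ρ = 1) : loopPos n K ≤
    degPart (LieModule.toEnd ℂ (loopAlg n K) (loopAlg n K) (loopGrading n K ρ)) above := by
  intro y hy
  refine mem_of_mem_tensorSub (J := ⊤) (nPos_le_derived hC) (fun a _ x hx => ?_) hy
  refine (loopTmul_mem_of_mem_lieSpan (e_mem_derived hC)
    (degSubalgebra (loopGrading n K ρ) above above_add) (fun a i => ?_) hx).2 a
  refine mem_degPart (μ := 1) (show (1 : ℂ) ∈ above from ⟨0, by simp⟩) ?_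
  rw [LieModule.toEnd_apply_apply, loopGrading_lie_e hC hρ, one_smul]

theorem loopCartan_le_degPart : loopCartan n K ≤
    degPart (LieModule.toEnd ℂ (loopAlg n K) (loopAlg n K) (loopGrading n K ρ)) {0} := by
  intro y hy
  rw [degPart_singleton, LieModule.toEnd_apply_apply, zero_smul]
  exact lie_loopCartan_loopCartan (cartanOne_mem_loopCartan _) hy

theorem loopGrading_lie_loopF (hC : IsGCM C) (hρ : ∀ i, R.root i ρ = 1) {y : loopAlg n K}
    (hy : y ∈ loopF n K) : ⁅loopGrading n K ρ, y⁆ = -y := by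
  have hle : Submodule.span ℂ (Set.range (fGen R)) ≤ R.derived.toSubmodule :=
    fSpan_le_nNeg.trans (nNeg_le_derived hC)
  have key : y ∈ degPart (LieModule.toEnd ℂ (loopAlg n K) (loopAlg n K) (loopGrading n K ρ)) {-1} := by
    refine mem_of_mem_tensorSub (J := ⊤) hle (fun a _ x hx => ?_) hy
    rw [degPart_singleton, LieModule.toEnd_apply_apply, loopGrading, cartanOne_lie_loopTmul]
    have hx' : ⁅cartanMap R ρ, x⁆ = -x := by
      have hl : Submodule.span ℂ (Set.range (fGen R)) ≤
          (LieModule.toEnd ℂ R.Alg R.Alg (cartanMap R ρ)).eigenspace (-1) := by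
        refine Submodule.span_le.2 ?_
        rintro _ ⟨i, rfl⟩
        rw [SetLike.mem_coe, Module.End.mem_eigenspace_iff, LieModule.toEnd_apply_apply,
          lie_cartan_f, hρ, neg_smul]
      have := Module.End.mem_eigenspace_iff.1 (hl hx)
      rwa [LieModule.toEnd_apply_apply, neg_smul, one_smul] at this
    apply Subtype.ext
    change a ⊗ₜ[ℂ] ⁅cartanMap R ρ, x⁆ = (-1 : ℂ) • (a ⊗ₜ[ℂ] x)
    rw [hx', TensorProduct.tmul_neg, neg_smul, one_smul]
  rw [degPart_singleton, LieModule.toEnd_apply_apply, neg_smul, one_smul] at key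
  exact key

theorem disjoint_loopCartan (hC : IsGCM C) (hρ : ∀ i, R.root i ρ = 1) :
    Disjoint (loopCartan n K)
      (degPart (LieModule.toEnd ℂ (loopAlg n K) (loopAlg n K) (loopGrading n K ρ)) (below 0) ⊔
        loopPos n K) := by
  refine (degPart_disjoint (Set.disjoint_union_right.2
    ⟨zero_disjoint_below, zero_disjoint_above⟩)).mono (loopCartan_le_degPart (ρ := ρ)) ?_
  exact sup_le (degPart_mono Set.subset_union_left)
    ((loopPos_le_degPart hC hρ).trans (degPart_mono Set.subset_union_right))

theorem disjoint_loopBorel (hC : IsGCM C) (hρ : ∀ i, R.root i ρ = 1) :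
    Disjoint
      (degPart (LieModule.toEnd ℂ (loopAlg n K) (loopAlg n K) (loopGrading n K ρ)) (below 0))
      (loopBorel n K) := by
  refine (degPart_disjoint (Set.disjoint_union_right.2
    ⟨zero_disjoint_below.symm, above_disjoint_below.symm⟩)).mono_right ?_
  exact sup_le ((loopCartan_le_degPart (ρ := ρ)).trans (degPart_mono Set.subset_union_left))
    ((loopPos_le_degPart hC hρ).trans (degPart_mono Set.subset_union_right))

/-- With the complement described by negative eigenvalues, disjointness is a matter of degrees, and
the triangular decomposition gives the rest. -/
theorem isCompl_loopBorel (hC : IsGCM C) (hρ : ∀ i, R.root i ρ = 1) :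
    IsCompl
      (degPart (LieModule.toEnd ℂ (loopAlg n K) (loopAlg n K) (loopGrading n K ρ)) (below 0))
      (loopBorel n K) := by
  refine ⟨disjoint_loopBorel hC hρ, codisjoint_iff.2 (eq_top_iff.2 fun y _ => ?_)⟩
  exact mem_of_triangular hC le_sup_right (fun a x hx =>
    Submodule.mem_sup_left (loopTmul_nNeg_mem_degPart hC hρ a hx _)) y

theorem isCompl_loopCartan (hC : IsGCM C) (hρ : ∀ i, R.root i ρ = 1) :
    IsCompl (loopCartan n K)
      (degPart (LieModule.toEnd ℂ (loopAlg n K) (loopAlg n K) (loopGrading n K ρ)) (below 0) ⊔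
        loopPos n K) := by
  refine ⟨disjoint_loopCartan hC hρ, codisjoint_iff.2 ?_⟩
  rw [sup_left_comm]
  exact (isCompl_loopBorel hC hρ).sup_eq_top

end LoopStructure

/-! ### Modules over U(L) as Lie modules over L. -/

section EnvelopingModules

variable {k L : Type*} [CommRing k] [LieRing L] [LieAlgebra k L] (X : Type*) [AddCommGroup X]
  [Module k X] [Module (UniversalEnvelopingAlgebra k L) X]
  [IsScalarTower k (UniversalEnvelopingAlgebra k L) X]

/-- The `L`-action on a `U(L)`-module. -/
abbrev envLieRingModule {k L : Type*} [CommRing k] [LieRing L] [LieAlgebra k L] (X : Type*)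
    [AddCommGroup X] [Module (UniversalEnvelopingAlgebra k L) X] : LieRingModule L X where
  bracket x m := UniversalEnvelopingAlgebra.ι k x • m
  add_lie x y m := by
    rw [map_add, add_smul]
  lie_add x m m' := smul_add _ m m'
  leibniz_lie x y m := by
    let _ := LieRing.ofAssociativeRing (A := UniversalEnvelopingAlgebra k L)
    let _ := LieAlgebra.ofAssociativeAlgebra (A := UniversalEnvelopingAlgebra k L) (R := k)
    change UniversalEnvelopingAlgebra.ι k x • UniversalEnvelopingAlgebra.ι k y • m =
      UniversalEnvelopingAlgebra.ι k ⁅x, y⁆ • m +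
        UniversalEnvelopingAlgebra.ι k y • UniversalEnvelopingAlgebra.ι k x • m
    have h : UniversalEnvelopingAlgebra.ι k ⁅x, y⁆ =
        UniversalEnvelopingAlgebra.ι k x * UniversalEnvelopingAlgebra.ι k y -
          UniversalEnvelopingAlgebra.ι k y * UniversalEnvelopingAlgebra.ι k x := by
      rw [LieHom.map_lie, LieRing.of_associative_ring_bracket]
    rw [h, sub_smul, mul_smul, mul_smul, sub_add_cancel]

theorem envLieModule :
    let _ : LieRingModule L X := envLieRingModule (k := k) X
    LieModule k L X := by
  intro _
  exact
    { smul_lie := fun t x m => by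
        change UniversalEnvelopingAlgebra.ι k (t • x) • m = t • UniversalEnvelopingAlgebra.ι k x • m
        rw [map_smul, smul_assoc]
      lie_smul := fun t x m => smul_comm (UniversalEnvelopingAlgebra.ι k x) t m }

end EnvelopingModules

/-! ### Highest weight modules, nonvanishing and irreducibility of V(ψ). -/

section HighestWeight

variable {ι : Type*} [Fintype ι] {C : Matrix ι ι ℤ}
  {𝔥 : Type*} [AddCommGroup 𝔥] [Module ℂ 𝔥] {R : Realization C 𝔥} {n : ℕ}
  {K : R.Complement} (ψ : Module.Dual ℂ (loopCartan n K))

/-- A cyclic highest weight vector of weight `ψ`. -/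
structure IsHighestWeight {X : Type*} [AddCommGroup X] [Module ℂ X]
    [LieRingModule (loopAlg n K) X] (v : X) : Prop where
  pos : ∀ y ∈ loopPos n K, ⁅y, v⁆ = 0
  cartan : ∀ y : loopCartan n K, ⁅(y : loopAlg n K), v⁆ = ψ y • v
  gen : ∀ N : LieSubmodule ℂ (loopAlg n K) X, v ∈ N → N = ⊤

/-- The degree of the highest weight vector. -/
def topDegree (ρ : 𝔥) : ℂ :=
  ψ ⟨loopGrading n K ρ, cartanOne_mem_loopCartan _⟩

variable {ψ}

namespace IsHighestWeight

variable {X : Type*} [AddCommGroup X] [Module ℂ X] [LieRingModule (loopAlg n K) X] {v : X} {ρ : 𝔥}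

theorem borel (h : IsHighestWeight ψ v) {b : loopAlg n K} (hb : b ∈ loopBorel n K) :
    ∃ t : ℂ, ⁅b, v⁆ = t • v := by
  obtain ⟨y, hy, z, hz, rfl⟩ := Submodule.mem_sup.1 hb
  exact ⟨ψ ⟨y, hy⟩, by rw [add_lie, h.pos z hz, add_zero, h.cartan ⟨y, hy⟩]⟩

theorem grading (h : IsHighestWeight ψ v) : ⁅loopGrading n K ρ, v⁆ = topDegree ψ ρ • v :=
  h.cartan ⟨loopGrading n K ρ, cartanOne_mem_loopCartan _⟩

variable [LieModule ℂ (loopAlg n K) X]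

/-- The line of v is stable under the Borel subalgebra, so the words applied to it form a submodule
containing the generator v. -/
theorem iSup_wordSpace (hC : IsGCM C) (h : IsHighestWeight ψ v) :
    (⨆ m, wordSpace (loopF n K) (ℂ ∙ v) m) = ⊤ := by
  have hW : ∀ b ∈ loopBorel n K, ∀ w ∈ (ℂ ∙ v : Submodule ℂ X), ⁅b, w⁆ ∈ (ℂ ∙ v : Submodule ℂ X) := by
    intro b hb w hw
    obtain ⟨a, rfl⟩ := Submodule.mem_span_singleton.1 hw
    obtain ⟨t, ht⟩ := h.borel hb
    rw [lie_smul, ht]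
    exact Submodule.smul_mem _ _ (Submodule.smul_mem _ _ (Submodule.mem_span_singleton_self v))
  have := h.gen (wordSubmodule (loopF n K) (loopBorel n K) (ℂ ∙ v) hW
    (fun b hb y hy => lie_loopBorel_loopF hC hb hy) (lieSpan_loopF_loopBorel hC))
    (le_iSup (wordSpace (loopF n K) (ℂ ∙ v)) 0 (Submodule.mem_span_singleton_self v))
  exact congrArg LieSubmodule.toSubmodule this

theorem not_mem_below (h : IsHighestWeight ψ v) (hv : v ≠ 0) :
    v ∉ degPart (LieModule.toEnd ℂ (loopAlg n K) X (loopGrading n K ρ))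
      (below (topDegree ψ ρ)) := by
  intro hmem
  refine hv (Submodule.disjoint_def.1 (degPart_disjoint (Set.disjoint_singleton_left.2
    (LoopKacMoody.not_mem_below (topDegree ψ ρ)))) v ?_ hmem)
  exact degPart_singleton.2 h.grading

theorem le_below (hC : IsGCM C) (hρ : ∀ i, R.root i ρ = 1) (h : IsHighestWeight ψ v)
    (N : LieSubmodule ℂ (loopAlg n K) X) (hN : N ≠ ⊤) :
    N.toSubmodule ≤ degPart (LieModule.toEnd ℂ (loopAlg n K) X (loopGrading n K ρ))
      (below (topDegree ψ ρ)) :=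
  le_degPart_below (fun _ hy => loopGrading_lie_loopF hC hρ hy) h.grading (h.iSup_wordSpace hC)
    (fun _ hw => N.lie_mem hw) (fun hv => hN (h.gen N hv))

end IsHighestWeight

instance : LieRingModule (loopAlg n K) (Verma ψ) := envLieRingModule (k := ℂ) (Verma ψ)

instance : LieModule ℂ (loopAlg n K) (Verma ψ) := envLieModule (Verma ψ)

instance : LieRingModule (loopAlg n K) (IrrMod ψ) := envLieRingModule (k := ℂ) (IrrMod ψ)

instance : LieModule ℂ (loopAlg n K) (IrrMod ψ) := envLieModule (IrrMod ψ)

theorem verma_isHighestWeight : IsHighestWeight ψ ((vermaIdeal ψ).mkQ 1) where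
  pos y hy := by
    change UniversalEnvelopingAlgebra.ι ℂ y • (vermaIdeal ψ).mkQ 1 = 0
    rw [← map_smul, smul_eq_mul, mul_one, Submodule.mkQ_apply, Submodule.Quotient.mk_eq_zero]
    exact Submodule.subset_span (Or.inl ⟨y, hy, rfl⟩)
  cartan y := by
    change UniversalEnvelopingAlgebra.ι ℂ (y : loopAlg n K) • (vermaIdeal ψ).mkQ 1 =
      ψ y • (vermaIdeal ψ).mkQ 1
    rw [← algebraMap_smul (Env n K) (ψ y), ← map_smul, ← map_smul, smul_eq_mul, mul_one,
      smul_eq_mul, mul_one, ← sub_eq_zero, ← map_sub, Submodule.mkQ_apply,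
      Submodule.Quotient.mk_eq_zero]
    exact Submodule.subset_span (Or.inr ⟨y, rfl⟩)
  gen N hN := by
    refine eq_top_iff.2 fun x _ => ?_
    obtain ⟨u, rfl⟩ := (vermaIdeal ψ).mkQ_surjective x
    have := enveloping_smul_mem N.toSubmodule (fun x w hw => N.lie_mem hw) u hN
    rwa [← map_smul, smul_eq_mul, mul_one] at this

theorem irrMod_isHighestWeight :
    IsHighestWeight ψ ((maxSub ψ).mkQ ((vermaIdeal ψ).mkQ 1)) where
  pos y hy := by
    change UniversalEnvelopingAlgebra.ι ℂ y • (maxSub ψ).mkQ _ = 0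
    rw [← map_smul]
    have h : UniversalEnvelopingAlgebra.ι ℂ y • (vermaIdeal ψ).mkQ 1 = 0 :=
      verma_isHighestWeight.pos y hy
    rw [h, map_zero]
  cartan y := by
    change UniversalEnvelopingAlgebra.ι ℂ (y : loopAlg n K) • (maxSub ψ).mkQ _ = _
    rw [← map_smul]
    have h : UniversalEnvelopingAlgebra.ι ℂ (y : loopAlg n K) • (vermaIdeal ψ).mkQ 1 =
      ψ y • (vermaIdeal ψ).mkQ 1 := verma_isHighestWeight.cartan y
    rw [h]
    rfl
  gen N hN := by
    refine eq_top_iff.2 fun x _ => ?_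
    obtain ⟨x, rfl⟩ := (maxSub ψ).mkQ_surjective x
    obtain ⟨u, rfl⟩ := (vermaIdeal ψ).mkQ_surjective x
    have := enveloping_smul_mem N.toSubmodule (fun x w hw => N.lie_mem hw) u hN
    rwa [← map_smul, ← map_smul, smul_eq_mul, mul_one] at this

/-- Extended by zero along the triangular decomposition, ψ is a character of the Borel subalgebra,
because brackets there lie in N⁺_A. Hence `exists_not_mem_leftIdeal` applies. -/
theorem verma_top_ne_zero [FiniteDimensional ℂ 𝔥] (hC : IsGCM C) :
    (vermaIdeal ψ).mkQ 1 ≠ 0 := by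
  obtain ⟨ρ, hρ⟩ := exists_grading R
  have hH := isCompl_loopCartan (n := n) (K := K) hC hρ
  have hB := isCompl_loopBorel (n := n) (K := K) hC hρ
  let lam : loopAlg n K →ₗ[ℂ] ℂ := ψ ∘ₗ (loopCartan n K).projectionOnto _ hH
  have hpos : ∀ y ∈ loopPos n K, lam y = 0 := by
    intro y hy
    have : (loopCartan n K).projectionOnto _ hH y = 0 :=
      Submodule.projectionOnto_apply_right hH ⟨y, Submodule.mem_sup_right hy⟩
    rw [LinearMap.comp_apply, this, map_zero]
  have hcar : ∀ y : loopCartan n K, lam y = ψ y := by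
    intro y
    rw [LinearMap.comp_apply, Submodule.projectionOnto_apply_left hH y]
  have key := exists_not_mem_leftIdeal
    (degSubalgebra (loopGrading n K ρ) (below 0) below_add) (loopBorel n K) hB
    (fun y hy z hz => Submodule.mem_sup_right (lie_loopBorel_loopBorel hy hz)) lam
    (fun y hy z hz => hpos _ (lie_loopBorel_loopBorel hy hz))
  rw [Submodule.mkQ_apply, Ne, Submodule.Quotient.mk_eq_zero]
  refine fun hmem => key (Submodule.span_le.2 ?_ hmem)
  rintro u (⟨y, hy, rfl⟩ | ⟨y, rfl⟩)
  · refine Submodule.subset_span ⟨y, Submodule.mem_sup_right hy, ?_⟩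
    rw [hpos y hy, map_zero, sub_zero]
  · refine Submodule.subset_span ⟨y, Submodule.mem_sup_left y.2, ?_⟩
    rw [hcar]

/-- A `U`-submodule as a Lie submodule. -/
def envToLie {X : Type*} [AddCommGroup X] [Module ℂ X] [Module (Env n K) X]
    [IsScalarTower ℂ (Env n K) X] [LieRingModule (loopAlg n K) X]
    (hX : ∀ (y : loopAlg n K) (x : X), ⁅y, x⁆ = UniversalEnvelopingAlgebra.ι ℂ y • x)
    (N : Submodule (Env n K) X) : LieSubmodule ℂ (loopAlg n K) X where
  toSubmodule := N.restrictScalars ℂ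
  lie_mem := fun {y x} hx => by
    rw [hX]
    exact N.smul_mem _ hx

/-- Each proper submodule of M(ψ) lies strictly below the top degree, and so does their sum; the
highest weight vector does not. -/
theorem irrMod_top_ne_zero [FiniteDimensional ℂ 𝔥] (hC : IsGCM C) :
    (maxSub ψ).mkQ ((vermaIdeal ψ).mkQ 1) ≠ 0 := by
  obtain ⟨ρ, hρ⟩ := exists_grading R
  rw [Submodule.mkQ_apply, Ne, Submodule.Quotient.mk_eq_zero]
  have hle : ∀ x ∈ maxSub ψ, x ∈ degPart (LieModule.toEnd ℂ (loopAlg n K) (Verma ψ)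
      (loopGrading n K ρ)) (below (topDegree ψ ρ)) := by
    intro x hx
    rw [maxSub, sSup_eq_iSup'] at hx
    induction hx using Submodule.iSup_induction' with
    | mem N x hx =>
      refine verma_isHighestWeight.le_below hC hρ (envToLie (fun _ _ => rfl) N.1) ?_ hx
      intro h
      refine N.2 (eq_top_iff.2 fun z _ => ?_)
      have : z ∈ envToLie (fun _ _ => rfl) N.1 := h ▸ LieSubmodule.mem_top z
      exact this
    | zero => exact zero_mem _
    | add x y _ _ hx hy => exact add_mem hx hy
  exact fun hmem => verma_isHighestWeight.not_mem_below (verma_top_ne_zero hC) (hle _ hmem)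

/-- `V(ψ)` is irreducible. -/
theorem irrMod_eq_bot (N : LieSubmodule ℂ (loopAlg n K) (IrrMod ψ)) (hN : N ≠ ⊤) :
    ∀ x ∈ N, x = 0 := by
  let N' : Submodule (Env n K) (IrrMod ψ) :=
    { carrier := N
      add_mem' := fun ha hb => N.add_mem' ha hb
      zero_mem' := N.zero_mem'
      smul_mem' := fun u x hx =>
        enveloping_smul_mem N.toSubmodule (fun x w hw => N.lie_mem hw) u hx }
  have h : N'.comap (maxSub ψ).mkQ ≠ ⊤ := by
    intro h
    refine hN (eq_top_iff.2 fun x _ => ?_)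
    obtain ⟨x, rfl⟩ := (maxSub ψ).mkQ_surjective x
    have : x ∈ N'.comap (maxSub ψ).mkQ := h ▸ Submodule.mem_top
    exact this
  have hle : N'.comap (maxSub ψ).mkQ ≤ maxSub ψ := le_sSup h
  intro x hx
  obtain ⟨x, rfl⟩ := (maxSub ψ).mkQ_surjective x
  rw [Submodule.mkQ_apply, Submodule.Quotient.mk_eq_zero]
  exact hle hx

/-! ### Vanishing of the action of 𝒢' ⊗ I. -/

/-- `𝒢' ⊗ I` as a subspace of `𝒢'_A ⊕ h''`. -/
def loopIdeal (K : R.Complement) (I : Ideal (Laurent n)) : Submodule ℂ (loopAlg n K) :=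
  (tensorSub (I.restrictScalars ℂ) R.derived.toSubmodule).comap (loopAlg n K).toSubmodule.subtype

theorem lie_loopIdeal {I : Ideal (Laurent n)} (x : loopAlg n K) {y : loopAlg n K}
    (hy : y ∈ loopIdeal K I) : ⁅x, y⁆ ∈ loopIdeal K I := by
  refine lie_mem_tensorSub_of (J := ⊤) (S := ⊤) (fun a _ b hb => I.mul_mem_left a hb)
    (fun x _ y _ => lie_mem_derived x y) ?_ hy
  refine (sup_le ?_ ?_ : (loopAlg n K).toSubmodule ≤ tensorSub ⊤ ⊤) x.2
  · exact tensorSub_mono le_rfl le_top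
  · exact (oneSub_le _).trans (tensorSub_mono le_rfl le_top)

theorem actsByZero [FiniteDimensional ℂ 𝔥] (hC : IsGCM C) {I : Ideal (Laurent n)}
    (hI : FactorsThrough ψ I) : ActsByZero ψ I := by
  obtain ⟨ρ, hρ⟩ := exists_grading R
  obtain ⟨χ, hχ⟩ := hI
  set v : IrrMod ψ := (maxSub ψ).mkQ ((vermaIdeal ψ).mkQ 1)
  have hhw : IsHighestWeight ψ v := irrMod_isHighestWeight
  have hv0 : v ≠ 0 := irrMod_top_ne_zero hC
  let act : loopAlg n K →ₗ[ℂ] IrrMod ψ :=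
    (LieModule.toEnd ℂ (loopAlg n K) (IrrMod ψ) : _ →ₗ[ℂ] Module.End ℂ (IrrMod ψ)).flip v
  -- W = (𝒢' ⊗ I)v is Borel-stable, since 𝒢' ⊗ I is an ideal and v is an eigenvector of the Borel
  -- subalgebra.
  let W : Submodule ℂ (IrrMod ψ) := (loopIdeal K I).map act
  have hW : ∀ b ∈ loopBorel n K, ∀ w ∈ W, ⁅b, w⁆ ∈ W := by
    rintro b hb _ ⟨y, hy, rfl⟩
    change ⁅b, ⁅y, v⁆⁆ ∈ W
    obtain ⟨t, ht⟩ := hhw.borel hb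
    rw [leibniz_lie, ht, lie_smul]
    exact add_mem ⟨⁅b, y⁆, lie_loopIdeal b hy, rfl⟩ (W.smul_mem t ⟨y, hy, rfl⟩)
  set D := LieModule.toEnd ℂ (loopAlg n K) (IrrMod ψ) (loopGrading n K ρ)
  have hWb : W ≤ degPart D (below (topDegree ψ ρ)) := by
    refine Submodule.map_le_iff_le_comap.2 fun y hy => ?_
    refine mem_of_mem_tensorSub (le_refl R.derived.toSubmodule) (fun a ha x hx => ?_) hy
    change ⁅loopTmul K a x hx, v⁆ ∈ degPart D (below (topDegree ψ ρ))
    obtain ⟨u, hu, p, hp, rfl⟩ := Submodule.mem_sup.1 (derived_le hx)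
    obtain ⟨m, hm, s, hs, rfl⟩ := Submodule.mem_sup.1 hu
    have he : loopTmul K a (m + s + p) hx = loopTmul K a m (nNeg_le_derived hC hm) +
        loopTmul K a s (corootSpan_le_derived hs) + loopTmul K a p (nPos_le_derived hC hp) := by
      apply Subtype.ext
      change a ⊗ₜ[ℂ] (m + s + p) = a ⊗ₜ[ℂ] m + a ⊗ₜ[ℂ] s + a ⊗ₜ[ℂ] p
      rw [TensorProduct.tmul_add, TensorProduct.tmul_add]
    have hs0 : ⁅loopTmul K a s (corootSpan_le_derived hs), v⁆ = 0 := by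
      have h1 := hhw.cartan (cartanTmul K a ⟨s, corootSpan_le_cartan' hs⟩)
      rw [hχ, Ideal.Quotient.eq_zero_iff_mem.2 ha, TensorProduct.zero_tmul, map_zero,
        zero_smul] at h1
      exact h1
    rw [he, add_lie, add_lie, hs0, hhw.pos _ (loopTmul_mem_loopPos _ hp), add_zero, add_zero]
    refine lie_mem_degPart (s := below 0) (t := {topDegree ψ ρ}) ?_
      (loopTmul_nNeg_mem_degPart hC hρ a hm _) (degPart_singleton.2 hhw.grading)
    rintro _ ⟨j, rfl⟩ _ rfl
    exact ⟨j, by ring⟩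
  let S := wordSubmodule (loopF n K) (loopBorel n K) W hW
    (fun b hb y hy => lie_loopBorel_loopF hC hb hy) (lieSpan_loopF_loopBorel hC)
  -- Words in the a ⊗ f_i only lower degrees further, so the submodule generated by W misses v.
  have hS : S ≠ ⊤ := by
    intro h
    refine hhw.not_mem_below (ρ := ρ) hv0 ?_
    have hle : (⨆ m, wordSpace (loopF n K) W m) ≤ degPart D (below (topDegree ψ ρ)) :=
      iSup_le fun m => wordSpace_le_degPart_below
        (fun _ hy => loopGrading_lie_loopF hC hρ hy) hWb m
    have : v ∈ S := h ▸ LieSubmodule.mem_top v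
    exact hle this
  have hJv : ∀ y ∈ loopIdeal K I, ⁅y, v⁆ = 0 := fun y hy =>
    irrMod_eq_bot S hS _ (le_iSup (wordSpace (loopF n K) W) 0 ⟨y, hy, rfl⟩)
  -- The vectors killed by an ideal form a submodule; this one contains the generator v.
  let Z : LieSubmodule ℂ (loopAlg n K) (IrrMod ψ) :=
    { carrier := {w | ∀ y ∈ loopIdeal K I, ⁅y, w⁆ = 0}
      add_mem' := fun ha hb y hy => by rw [lie_add, ha y hy, hb y hy, add_zero]
      zero_mem' := fun y _ => lie_zero y
      smul_mem' := fun c w hw y hy => by rw [lie_smul, hw y hy, smul_zero]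
      lie_mem := fun {x w} hw y hy => by
        rw [leibniz_lie, hw y hy, lie_zero, add_zero, ← lie_skew, neg_lie,
          hw _ (lie_loopIdeal x hy), neg_zero] }
  have hZ : Z = ⊤ := hhw.gen Z hJv
  intro y hy w
  have : w ∈ Z := hZ ▸ LieSubmodule.mem_top w
  exact this y hy

/-! ### Finite dimensional weight spaces from a cofinite ideal. -/

/-- The map `a ↦ a ⊗ x`. -/
def loopTmulLin (K : R.Complement) (x : R.Alg) (hx : x ∈ R.derived) :
    Laurent n →ₗ[ℂ] loopAlg n K where
  toFun a := loopTmul K a x hx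
  map_add' a b := Subtype.ext (TensorProduct.add_tmul a b x)
  map_smul' c a := Subtype.ext (TensorProduct.smul_tmul' c a x)

theorem loopF_le (hC : IsGCM C) : loopF n K ≤
    ⨆ i, LinearMap.range (loopTmulLin (n := n) K (fGen R i) (f_mem_derived hC i)) := by
  intro y hy
  refine mem_of_mem_tensorSub (fSpan_le_nNeg.trans (nNeg_le_derived hC)) (fun a _ x hx => ?_) hy
  have hx' := hx
  revert hx'
  refine Submodule.span_induction (p := fun x _ => ∀ h : x ∈ R.derived, loopTmul K a x h ∈ _)
    ?_ ?_ ?_ ?_ hx |> fun h hx' => h (nNeg_le_derived hC (fSpan_le_nNeg hx'))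
  · rintro _ ⟨i, rfl⟩ h
    exact le_iSup (fun i => LinearMap.range
      (loopTmulLin (n := n) K (fGen R i) (f_mem_derived hC i))) i ⟨a, rfl⟩
  · intro h
    have he : loopTmul K a (0 : R.Alg) h = 0 := Subtype.ext (TensorProduct.tmul_zero _ _)
    rw [he]
    exact zero_mem _
  · intro x y hx hy ihx ihy h
    have hx' := nNeg_le_derived hC (fSpan_le_nNeg hx)
    have hy' := nNeg_le_derived hC (fSpan_le_nNeg hy)
    have he : loopTmul K a (x + y) h = loopTmul K a x hx' + loopTmul K a y hy' :=
      Subtype.ext (TensorProduct.tmul_add _ _ _)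
    rw [he]
    exact add_mem (ihx hx') (ihy hy')
  · intro c x hx ihx h
    have hx' := nNeg_le_derived hC (fSpan_le_nNeg hx)
    have he : loopTmul K a (c • x) h = c • loopTmul K a x hx' :=
      Subtype.ext (TensorProduct.tmul_smul _ _ _)
    rw [he]
    exact Submodule.smul_mem _ _ (ihx hx')

theorem finiteDimensional_range_of_le_ker {k V W : Type*} [Field k] [AddCommGroup V] [Module k V]
    [AddCommGroup W] [Module k W] {N : Submodule k V} (g : V →ₗ[k] W) (hN : N ≤ LinearMap.ker g)
    (hfin : FiniteDimensional k (V ⧸ N)) : FiniteDimensional k (LinearMap.range g) := by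
  rw [← Submodule.range_liftQ N g hN]
  infer_instance

theorem finiteDimensional_quotient_ker {k V W : Type*} [Field k] [AddCommGroup V] [Module k V]
    [AddCommGroup W] [Module k W] (g : V →ₗ[k] W) [FiniteDimensional k W] :
    FiniteDimensional k (V ⧸ LinearMap.ker g) :=
  LinearEquiv.finiteDimensional g.quotKerEquivRange.symm

theorem finiteDimensional_map_iSup_range {k A V W ι : Type*} [Field k] [Finite ι] [AddCommGroup A]
    [Module k A] [AddCommGroup V] [Module k V] [AddCommGroup W] [Module k W] {N : Submodule k A}
    (g : ι → A →ₗ[k] V) (f : V →ₗ[k] W) (hN : ∀ i, ∀ a ∈ N, f (g i a) = 0)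
    (hfin : FiniteDimensional k (A ⧸ N)) :
    FiniteDimensional k ((⨆ i, LinearMap.range (g i)).map f) := by
  rw [Submodule.map_iSup]
  have : ∀ i, FiniteDimensional k ((LinearMap.range (g i)).map f) := by
    intro i
    rw [← LinearMap.range_comp]
    exact finiteDimensional_range_of_le_ker (N := N) _ (fun a ha => hN i a ha) hfin
  exact Submodule.finiteDimensional_iSup _

/-- For each of the finitely many i, the action of a ⊗ f_i depends only on the class of a in A/I. -/
theorem finiteDimensional_loopF_map (hC : IsGCM C) {X : Type*} [AddCommGroup X] [Module ℂ X]
    [LieRingModule (loopAlg n K) X] [LieModule ℂ (loopAlg n K) X] {I : Ideal (Laurent n)}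
    (hfin : FiniteDimensional ℂ (Laurent n ⧸ I))
    (hact : ∀ y ∈ loopIdeal K I, ∀ x : X, ⁅y, x⁆ = 0) :
    FiniteDimensional ℂ ((loopF n K).map
      (LieModule.toEnd ℂ (loopAlg n K) X : loopAlg n K →ₗ[ℂ] Module.End ℂ X)) := by
  have hfin' : FiniteDimensional ℂ (Laurent n ⧸ I.restrictScalars ℂ) :=
    LinearEquiv.finiteDimensional (Submodule.Quotient.restrictScalarsEquiv ℂ I).symm
  have h := finiteDimensional_map_iSup_range (N := I.restrictScalars ℂ)
    (fun i => loopTmulLin (n := n) K (fGen R i) (f_mem_derived hC i))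
    (LieModule.toEnd ℂ (loopAlg n K) X : loopAlg n K →ₗ[ℂ] Module.End ℂ X) (fun i a ha => by
      ext w
      exact hact _ (tmul_mem_tensorSub ha (f_mem_derived hC i)) w) hfin'
  exact Submodule.finiteDimensional_of_le (Submodule.map_mono (loopF_le hC))

theorem hasFinDimWeightSpaces [FiniteDimensional ℂ 𝔥] (hC : IsGCM C) {I : Ideal (Laurent n)}
    (hfin : FiniteDimensional ℂ (Laurent n ⧸ I)) (hI : FactorsThrough ψ I) :
    HasFinDimWeightSpaces ψ := by
  obtain ⟨ρ, hρ⟩ := exists_grading R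
  have hact := actsByZero hC hI
  set v : IrrMod ψ := (maxSub ψ).mkQ ((vermaIdeal ψ).mkQ 1)
  have hhw : IsHighestWeight ψ v := irrMod_isHighestWeight
  intro μ
  obtain ⟨m, hm⟩ := eigenspace_le_wordSpace (fun _ hy => loopGrading_lie_loopF hC hρ hy)
    (hhw.grading (ρ := ρ)) (hhw.iSup_wordSpace hC)
    (μ ⟨cartanMap R ρ, cartanMap_mem R ρ⟩)
  have hword := wordSpace_finiteDimensional
    (finiteDimensional_loopF_map (X := IrrMod ψ) hC hfin fun y hy w => hact y hy w)
    (inferInstance : FiniteDimensional ℂ (ℂ ∙ v : Submodule ℂ (IrrMod ψ))) m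
  -- Of the weight condition only the eigenvalue of the grading element is used.
  have hle : weightSpace ψ μ ≤ wordSpace (loopF n K) (ℂ ∙ v) m := by
    refine le_trans (fun w hw => ?_) hm
    exact Module.End.mem_eigenspace_iff.2 (hw ⟨cartanMap R ρ, cartanMap_mem R ρ⟩)
  exact Submodule.finiteDimensional_of_le hle

/-! ### A cofinite ideal from finite dimensional weight spaces. -/

/-- The restriction of `ψ` to `h' ⊗ A` as a bilinear map. -/
def loopPairing (ψ : Module.Dual ℂ (loopCartan n K)) : Laurent n →ₗ[ℂ] R.cartan' →ₗ[ℂ] ℂ :=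
  LinearMap.mk₂ ℂ (fun a x => ψ (cartanTmul K a x))
    (fun a b x => by
      rw [← map_add]
      exact congrArg ψ (Subtype.ext (Subtype.ext (TensorProduct.add_tmul a b _))))
    (fun c a x => by
      rw [← map_smul]
      exact congrArg ψ (Subtype.ext (Subtype.ext (TensorProduct.smul_tmul' c a _))))
    (fun a x y => by
      rw [← map_add]
      exact congrArg ψ (Subtype.ext (Subtype.ext (TensorProduct.tmul_add a _ _))))
    (fun c a x => by
      rw [← map_smul]
      exact congrArg ψ (Subtype.ext (Subtype.ext (TensorProduct.tmul_smul c a _))))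

/-- The functional on A/I ⊗ h' comes from a linear section of A → A/I; the choice is harmless
because the pairing vanishes on I. -/
theorem factorsThrough_of_forall {I : Ideal (Laurent n)}
    (h : ∀ a ∈ I, ∀ x, ψ (cartanTmul K a x) = 0) : FactorsThrough ψ I := by
  let q : Laurent n →ₗ[ℂ] Laurent n ⧸ I := (Ideal.Quotient.mkₐ ℂ I).toLinearMap
  obtain ⟨s, hs⟩ := q.exists_rightInverse_of_surjective
    (LinearMap.range_eq_top.2 Ideal.Quotient.mk_surjective)
  refine ⟨TensorProduct.lift (loopPairing ψ ∘ₗ s), fun a x => ?_⟩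
  rw [TensorProduct.lift.tmul, LinearMap.comp_apply]
  have hmem : a - s (Ideal.Quotient.mk I a) ∈ I := by
    rw [← Ideal.Quotient.eq_zero_iff_mem, map_sub, sub_eq_zero]
    exact (LinearMap.congr_fun hs (Ideal.Quotient.mk I a)).symm
  have h0 : loopPairing ψ (a - s (Ideal.Quotient.mk I a)) x = 0 := h _ hmem x
  rw [map_sub, LinearMap.sub_apply, sub_eq_zero] at h0
  exact h0

theorem exists_cofinite [FiniteDimensional ℂ 𝔥] (hC : IsGCM C) (hfin : HasFinDimWeightSpaces ψ) :
    ∃ I : Ideal (Laurent n), FiniteDimensional ℂ (Laurent n ⧸ I) ∧ FactorsThrough ψ I := by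
  set v : IrrMod ψ := (maxSub ψ).mkQ ((vermaIdeal ψ).mkQ 1)
  have hhw : IsHighestWeight ψ v := irrMod_isHighestWeight
  have hv0 : v ≠ 0 := irrMod_top_ne_zero hC
  have hf := fun i => f_mem_derived (R := R) hC i
  have hco := fun i => corootSpan_le_cartan' (coroot_mem R i)
  let I : Ideal (Laurent n) :=
    { carrier := {a | ∀ i, ⁅loopTmul K a (fGen R i) (hf i), v⁆ = 0}
      add_mem' := fun {a b} ha hb i => by
        have he := (loopTmulLin (n := n) K (fGen R i) (hf i)).map_add a b
        change loopTmul K (a + b) (fGen R i) (hf i) = loopTmul K a (fGen R i) (hf i) +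
          loopTmul K b (fGen R i) (hf i) at he
        rw [he, add_lie, ha i, hb i, add_zero]
      zero_mem' := fun i => by
        have he := (loopTmulLin (n := n) K (fGen R i) (hf i)).map_zero
        change loopTmul K 0 (fGen R i) (hf i) = 0 at he
        rw [he, zero_lie]
      -- Applying b ⊗ α_i^∨ to (a ⊗ f_i)v = 0 yields -2(ba ⊗ f_i)v = 0, because v is an eigenvector
      -- of b ⊗ α_i^∨ and α_i(α_i^∨) = 2.
      smul_mem' := fun b a ha i => by
        have h1 := leibniz_lie (cartanTmul K b ⟨_, hco i⟩ : loopAlg n K)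
          (loopTmul K a (fGen R i) (hf i)) v
        rw [ha i, lie_zero, hhw.cartan, lie_smul, ha i, smul_zero, add_zero] at h1
        have he : ⁅(cartanTmul K b ⟨_, hco i⟩ : loopAlg n K), loopTmul K a (fGen R i) (hf i)⁆ =
            (-2 : ℂ) • loopTmul K (b • a) (fGen R i) (hf i) := by
          apply Subtype.ext
          change (b * a) ⊗ₜ[ℂ] ⁅cartanMap R (R.coroot i), fGen R i⁆ =
            (-2 : ℂ) • ((b * a) ⊗ₜ[ℂ] fGen R i)
          rw [lie_cartan_f, root_coroot_self hC, ← neg_smul, TensorProduct.tmul_smul]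
        rw [he, smul_lie] at h1
        exact (smul_eq_zero.1 h1.symm).resolve_left (by norm_num) }
  choose α hα using exists_root_on_cartan (R := R)
  let cOne : R.cartan →ₗ[ℂ] loopCartan n K :=
    { toFun := fun x => ⟨cartanOne n K x, cartanOne_mem_loopCartan x⟩
      map_add' := fun x y => Subtype.ext (Subtype.ext (TensorProduct.tmul_add _ _ _))
      map_smul' := fun c x => Subtype.ext (Subtype.ext (TensorProduct.tmul_smul _ _ _)) }
  let g : ∀ i, Laurent n →ₗ[ℂ] weightSpace ψ (ψ ∘ₗ cOne - α i) := fun i =>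
    LinearMap.codRestrict _
      ((LieModule.toEnd ℂ (loopAlg n K) (IrrMod ψ) : _ →ₗ[ℂ] Module.End ℂ (IrrMod ψ)).flip v ∘ₗ
        loopTmulLin K (fGen R i) (hf i)) (by
      intro a x
      change ⁅cartanOne n K x, ⁅loopTmul K a (fGen R i) (hf i), v⁆⁆ =
        (ψ (cOne x) - α i x) • ⁅loopTmul K a (fGen R i) (hf i), v⁆
      have he : loopTmul K a ⁅(x : R.Alg), fGen R i⁆ (lie_mem_derived _ _) =
          -(α i x • loopTmul K a (fGen R i) (hf i)) := by
        apply Subtype.ext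
        change a ⊗ₜ[ℂ] ⁅(x : R.Alg), fGen R i⁆ = -(α i x • (a ⊗ₜ[ℂ] fGen R i))
        rw [hα, TensorProduct.tmul_neg, TensorProduct.tmul_smul]
      have hc : ⁅cartanOne n K x, v⁆ = ψ (cOne x) • v := hhw.cartan (cOne x)
      rw [leibniz_lie, cartanOne_lie_loopTmul, he, hc, lie_smul, neg_lie, smul_lie, sub_smul]
      abel)
  -- The kernel of a ↦ ((a ⊗ f_i)v)_i is I, and the target is a finite product of finite dimensional
  -- weight spaces.
  let G : Laurent n →ₗ[ℂ] ∀ i, weightSpace ψ (ψ ∘ₗ cOne - α i) := LinearMap.pi g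
  have hker : LinearMap.ker G = I.restrictScalars ℂ := by
    ext a
    rw [LinearMap.mem_ker, funext_iff]
    exact forall_congr' fun i => Subtype.ext_iff
  refine ⟨I, ?_, factorsThrough_of_forall fun a ha x => ?_⟩
  · have := fun i => hfin (ψ ∘ₗ cOne - α i)
    have h1 : FiniteDimensional ℂ (Laurent n ⧸ LinearMap.ker G) :=
      finiteDimensional_quotient_ker G
    rw [hker] at h1
    exact LinearEquiv.finiteDimensional (Submodule.Quotient.restrictScalarsEquiv ℂ I)
  · have hle : corootSpan R ≤ (LinearMap.ker (loopPairing ψ a)).map R.cartan'.subtype := by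
      refine Submodule.span_le.2 ?_
      rintro _ ⟨i, rfl⟩
      refine ⟨⟨_, hco i⟩, ?_, rfl⟩
      change ψ (cartanTmul K a ⟨_, hco i⟩) = 0
      -- As 1 ⊗ e_i kills v, applying it to (a ⊗ f_i)v = 0 leaves (a ⊗ α_i^∨)v = ψ(a ⊗ α_i^∨)v, and
      -- v ≠ 0.
      have h1 := leibniz_lie (loopTmul (n := n) K 1 (eGen R i) (e_mem_derived hC i))
        (loopTmul K a (fGen R i) (hf i)) v
      rw [ha i, lie_zero, hhw.pos _ (loopTmul_mem_loopPos _ (e_mem R i)), lie_zero,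
        add_zero] at h1
      have he : ⁅loopTmul (n := n) K 1 (eGen R i) (e_mem_derived hC i), loopTmul K a (fGen R i) (hf i)⁆ =
          (cartanTmul K a ⟨_, hco i⟩ : loopAlg n K) := by
        apply Subtype.ext
        change ((1 : Laurent n) * a) ⊗ₜ[ℂ] ⁅eGen R i, fGen R i⁆ =
          a ⊗ₜ[ℂ] cartanMap R (R.coroot i)
        rw [one_mul, lie_e_f_same]
      rw [he, hhw.cartan] at h1
      exact (smul_eq_zero.1 h1.symm).resolve_right hv0
    have hx : (x : R.Alg) ∈ corootSpan R := cartan'_eq (R := R) ▸ x.2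
    obtain ⟨z, hz, hzx⟩ := hle hx
    have : z = x := Subtype.ext hzx
    exact this ▸ hz

end HighestWeight

end LoopKacMoody

end

theorem mainTheorem9 {ι : Type*} [Fintype ι] (C : Matrix ι ι ℤ) (hC : LoopKacMoody.IsGCM C)
    {𝔥 : Type*} [AddCommGroup 𝔥] [Module ℂ 𝔥] [FiniteDimensional ℂ 𝔥]
    (R : LoopKacMoody.Realization C 𝔥) (K : R.Complement)
    (n : ℕ) (hn : 0 < n) (ψ : Module.Dual ℂ (LoopKacMoody.loopCartan n K)) :
    (LoopKacMoody.HasFinDimWeightSpaces ψ ↔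
      ∃ I : Ideal (LoopKacMoody.Laurent n),
        FiniteDimensional ℂ (LoopKacMoody.Laurent n ⧸ I) ∧
          LoopKacMoody.FactorsThrough ψ I) ∧
    ∀ I : Ideal (LoopKacMoody.Laurent n),
      FiniteDimensional ℂ (LoopKacMoody.Laurent n ⧸ I) →
        LoopKacMoody.FactorsThrough ψ I → LoopKacMoody.ActsByZero ψ I :=
  ⟨⟨LoopKacMoody.exists_cofinite hC,
    fun ⟨_, hfin, hI⟩ => LoopKacMoody.hasFinDimWeightSpaces hC hfin hI⟩,
    fun _ _ hI => LoopKacMoody.actsByZero hC hI⟩
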